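/- Let $d\ge 2$, let $\mathbf F_d$ be the free group on $d$ generators $x_1,\dots,x_d$, and let $|\gamma|$ be the word length of $\gamma\in\mathbf F_d$ with respect to $S=\{x_1^{\pm1},\dots,x_d^{\pm1}\}$. Let $\mathrm{Iso}(\mathbf F_d)$ be the group, under composition, of all bijections $f:\mathbf F_d\to\mathbf F_d$ such that $|f(\gamma)^{-1}f(\delta)|=|\gamma^{-1}\delta|$ for all $\gamma,\delta\in\mathbf F_d$; with the topology of pointwise convergence it is a locally compact group, and it contains the discrete group $\mathbf F_d$, acting on itself by left multiplication. For a subgroup $\Lambda\le\mathbf F_d$, let $\mathrm{Iso}(\mathbf F_d)/\Lambda$ be the quotient of $\mathrm{Iso}(\mathbf F_d)$ by the action of $\Lambda$ by postcomposition, $\lambda\cdot f=(\gamma\mapsto\lambda f(\gamma))$. The group $\mathrm{Iso}(\mathbf F_d)$ acts on it by $g\cdot[f]=[f\circ g^{-1}]$, and $\mathbf F_d$ acts on it by restriction. If $\Lambda$ has finite index in $\mathbf F_d$, let $m_\Lambda$ be the Haar probability measure on $\mathrm{Iso}(\mathbf F_d)/\Lambda$, that is, the push-forward to the quotient of the restriction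 of a Haar measure of $\mathrm{Iso}(\mathbf F_d)$ to a fundamental domain of $\Lambda$, rescaled to have mass one. A probability-measure-preserving (p.m.p.) action of a locally compact group $G$ on $(X,\mu)$ is called mixing if for all measurable $A,B\subseteq X$ and all $\varepsilon>0$ the set $\{g\in G:\ |\mu(gA\cap B)-\mu(A)\mu(B)|\ge\varepsilon\}$ is compact. The even subgroup of $\mathbf F_d$ is $\mathbf F_d^{ev}=\{\gamma\in\mathbf F_d:\ |\gamma|\text{ is even}\}$. Theorem. Let $\Lambda\le\mathbf F_d$ be a finite index subgroup. Then $m_\Lambda$ is a probability measure that is invariant under $\mathrm{Iso}(\mathbf F_d)$, and the following conditions are equivalent. (i) The p.m.p. action of $\mathrm{Iso}(\mathbf F_d)$ on $(\mathrm{Iso}(\mathbf F_d)/\Lambda,m_\Lambda)$ is mixing. (ii) The p.m.p. action of $\mathbf F_d$ on $(\mathrm{Iso}(\mathbf F_d)/\Lambda,m_\Lambda)$ is mixing. (iii) $\Lambda$ is not contained in the even subgroup $\mathbf F_d^{ev}$. -/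

import Mathlib

open MeasureTheory

namespace FreeIso

/-- The free group `F_d` on `d` generators. For `γ : F d`, `γ.norm` is the length of the reduced
word of `γ`, that is, its word length with respect to the generators and their inverses. -/
abbrev F (d : ℕ) : Type := FreeGroup (Fin d)

/-- `F_d` carries the discrete topology. -/
instance (d : ℕ) : TopologicalSpace (F d) := ⊥

instance (d : ℕ) : DiscreteTopology (F d) := ⟨rfl⟩

/-- The group `Iso(F_d)` of all bijections of `F_d` that preserve the word metric
`(γ, δ) ↦ |γ⁻¹ δ|`, under composition. -/
def Iso (d : ℕ) : Subgroup (Equiv.Perm (F d)) where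
  carrier := {f | ∀ γ δ : F d, ((f γ)⁻¹ * f δ).norm = (γ⁻¹ * δ).norm}
  mul_mem' := by
    intro f g hf hg γ δ
    have h1 := hf (g γ) (g δ)
    have h2 := hg γ δ
    simp only [Equiv.Perm.mul_apply]
    rw [h1, h2]
  one_mem' := by intro γ δ; rfl
  inv_mem' := by
    intro f hf γ δ
    have h := hf (f⁻¹ γ) (f⁻¹ δ)
    change ((f (f.symm γ))⁻¹ * f (f.symm δ)).norm = _ at h
    rw [Equiv.apply_symm_apply, Equiv.apply_symm_apply] at h
    exact h.symm

/-- The topology of pointwise convergence on `Iso(F_d)`. -/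
instance (d : ℕ) : TopologicalSpace (Iso d) :=
  TopologicalSpace.induced (fun (f : Iso d) (γ : F d) => f.1 γ) inferInstance

instance (d : ℕ) : MeasurableSpace (Iso d) := borel (Iso d)

instance (d : ℕ) : BorelSpace (Iso d) := ⟨rfl⟩

theorem continuous_eval {d : ℕ} (γ : F d) : Continuous (fun f : Iso d => f.1 γ) :=
  (continuous_apply γ).comp continuous_induced_dom

theorem isOpen_eval {d : ℕ} (γ δ : F d) : IsOpen {f : Iso d | f.1 γ = δ} :=
  (isOpen_discrete ({δ} : Set (F d))).preimage (continuous_eval γ)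

instance (d : ℕ) : IsTopologicalGroup (Iso d) where
  continuous_mul := by
    refine continuous_induced_rng.2 (continuous_pi fun γ => ?_)
    refine continuous_iff_continuousAt.2 fun p => ?_
    refine (continuousAt_const (y := p.1.1 (p.2.1 γ))).congr ?_
    have h1 := ((isOpen_eval (p.2.1 γ) (p.1.1 (p.2.1 γ))).preimage
      (continuous_fst (X := Iso d) (Y := Iso d))).mem_nhds (x := p) rfl
    have h2 := ((isOpen_eval γ (p.2.1 γ)).preimage
      (continuous_snd (X := Iso d) (Y := Iso d))).mem_nhds (x := p) rfl
    filter_upwards [h1, h2] with q hq1 hq2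
    have e1 : q.1.1 (p.2.1 γ) = p.1.1 (p.2.1 γ) := hq1
    have e2 : q.2.1 γ = p.2.1 γ := hq2
    change p.1.1 (p.2.1 γ) = q.1.1 (q.2.1 γ)
    rw [e2, e1]
  continuous_inv := by
    refine continuous_induced_rng.2 (continuous_pi fun γ => ?_)
    refine continuous_iff_continuousAt.2 fun p => ?_
    refine (continuousAt_const (y := p.1⁻¹ γ)).congr ?_
    have h1 := (isOpen_eval (p.1⁻¹ γ) γ).mem_nhds (x := p) (by simp)
    filter_upwards [h1] with q hq
    have e : q.1 (p.1⁻¹ γ) = γ := hq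
    change p.1⁻¹ γ = q.1⁻¹ γ
    rw [Equiv.Perm.eq_inv_iff_eq, e]

theorem finite_norm_le (d n : ℕ) : {γ : F d | γ.norm ≤ n}.Finite :=
  Set.Finite.of_injOn (f := FreeGroup.toWord) (t := {l | l.length ≤ n})
    (fun _ hγ => hγ) FreeGroup.toWord_injective.injOn (List.finite_length_le _ n)

/-- The stabilizer of the identity is compact. -/
theorem isCompact_stabilizer (d : ℕ) : IsCompact {f : Iso d | f.1 1 = 1} := by
  let Φ : Iso d → (F d → F d) × (F d → F d) := fun f => (fun γ => f.1 γ, fun γ => f.1⁻¹ γ)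
  have hΦ : Topology.IsInducing Φ := by
    refine Topology.IsInducing.of_comp (g := Prod.fst) ?_ continuous_fst ⟨rfl⟩
    exact Continuous.prodMk (continuous_pi continuous_eval)
      (continuous_pi fun γ => (continuous_eval γ).comp continuous_inv)
  rw [hΦ.isCompact_iff]
  let B : Set (F d → F d) := Set.pi Set.univ fun γ => {δ | δ.norm ≤ γ.norm}
  have hB : IsCompact B := isCompact_univ_pi fun γ => (finite_norm_le d _).isCompact
  refine (hB.prod hB).of_isClosed_subset (?_ : IsClosed (Φ '' _)) ?_
  · have heq : Φ '' {f : Iso d | f.1 1 = 1} = {p | p.1 1 = 1} ∩ ((⋂ γ, {p | p.1 (p.2 γ) = γ}) ∩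
        ((⋂ γ, {p | p.2 (p.1 γ) = γ}) ∩
        ⋂ γ, ⋂ δ, {p | ((p.1 γ)⁻¹ * p.1 δ).norm = (γ⁻¹ * δ).norm})) := by
      ext p
      simp only [Set.mem_image, Set.mem_inter_iff, Set.mem_iInter, Set.mem_ofPred_eq]
      constructor
      · rintro ⟨f, hf, rfl⟩
        exact ⟨hf, fun γ => by simp [Φ], fun γ => by simp [Φ], f.2⟩
      · rintro ⟨h1, h2, h3, h4⟩
        exact ⟨⟨⟨p.1, p.2, h3, h2⟩, h4⟩, h1, rfl⟩
    rw [heq]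
    have c1 : ∀ γ : F d, Continuous fun p : (F d → F d) × (F d → F d) => p.1 γ :=
      fun γ => (continuous_apply γ).comp continuous_fst
    have c2 : ∀ γ : F d, Continuous fun p : (F d → F d) × (F d → F d) => p.2 γ :=
      fun γ => (continuous_apply γ).comp continuous_snd
    have ev : Continuous fun q : (F d → F d) × F d => q.1 q.2 :=
      continuous_prod_of_discrete_right.2 fun γ => continuous_apply γ
    refine (isClosed_eq (c1 1) continuous_const).inter ((isClosed_iInter fun γ => ?_).inter
      ((isClosed_iInter fun γ => ?_).inter (isClosed_iInter fun γ => isClosed_iInter fun δ => ?_)))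
    · exact isClosed_eq (ev.comp (continuous_fst.prodMk (c2 γ))) continuous_const
    · exact isClosed_eq (ev.comp (continuous_snd.prodMk (c1 γ))) continuous_const
    · exact (isClosed_discrete {q : F d × F d | (q.1⁻¹ * q.2).norm = (γ⁻¹ * δ).norm}).preimage
        ((c1 γ).prodMk (c1 δ))
  · rintro _ ⟨f, hf, rfl⟩
    have hf1 : f.1 1 = 1 := hf
    have hf2 : (f⁻¹).1 1 = 1 := by
      change f.1⁻¹ 1 = 1
      rw [Equiv.Perm.inv_eq_iff_eq, hf1]
    refine ⟨fun γ _ => ?_, fun γ _ => ?_⟩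
    · have h := f.2 1 γ
      rw [hf1, inv_one, one_mul, one_mul] at h
      exact h.le
    · have h := (f⁻¹).2 1 γ
      rw [hf2, inv_one, one_mul, one_mul] at h
      exact h.le

instance (d : ℕ) : LocallyCompactSpace (Iso d) :=
  (isCompact_stabilizer d).locallyCompactSpace_of_mem_nhds_of_group
    ((isOpen_eval 1 1).mem_nhds (x := (1 : Iso d)) rfl)

/-- The canonical embedding of `F_d` in `Iso(F_d)` by left multiplication. -/
def leftMul (d : ℕ) : F d →* Iso d where
  toFun γ := ⟨Equiv.mulLeft γ, fun δ ε => by simp⟩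
  map_one' := by ext δ; simp
  map_mul' γ γ' := by ext δ; simp

/-- The quotient `Iso(F_d)/Λ` of `Iso(F_d)` by the action of `Λ ≤ F_d` by postcomposition,
`λ · f = (γ ↦ λ f(γ))`. -/
def IsoQuotient {d : ℕ} (Λ : Subgroup (F d)) : Type :=
  MulAction.orbitRel.Quotient (Λ.map (leftMul d)) (Iso d)

/-- The quotient map `Iso(F_d) → Iso(F_d)/Λ`. -/
def proj {d : ℕ} (Λ : Subgroup (F d)) (f : Iso d) : IsoQuotient Λ :=
  Quotient.mk _ f

/-- The quotient Borel structure: a set is measurable if and only if its preimage in `Iso(F_d)` is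
a Borel set. -/
instance {d : ℕ} (Λ : Subgroup (F d)) : MeasurableSpace (IsoQuotient Λ) :=
  MeasurableSpace.map (proj Λ) inferInstance

/-- `Iso(F_d)` acts on `Iso(F_d)/Λ` by precomposition by the inverse: `g · [f] = [f ∘ g⁻¹]`. -/
instance {d : ℕ} (Λ : Subgroup (F d)) : MulAction (Iso d) (IsoQuotient Λ) where
  smul g := Quotient.map (fun f => f * g⁻¹) (by
    rintro _ f ⟨l, rfl⟩
    exact ⟨l, by simp [Subgroup.smul_def, mul_assoc]⟩)
  one_smul := by
    rintro ⟨f⟩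
    exact congrArg (proj Λ) (by simp : f * (1 : Iso d)⁻¹ = f)
  mul_smul := by
    rintro g h ⟨f⟩
    exact congrArg (proj Λ) (by simp [mul_assoc] : f * (g * h)⁻¹ = f * h⁻¹ * g⁻¹)

/-- `F_d` acts on `Iso(F_d)/Λ` as a subgroup of `Iso(F_d)`. -/
instance {d : ℕ} (Λ : Subgroup (F d)) : MulAction (F d) (IsoQuotient Λ) :=
  MulAction.compHom _ (leftMul d)

/-- A fundamental domain for the action of `Λ` on `Iso(F_d)` by postcomposition: those `f` for which
`f(1)` is the chosen representative of its coset `Λ f(1)`. -/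
def fundDomain {d : ℕ} (Λ : Subgroup (F d)) : Set (Iso d) :=
  {f | (Quotient.mk (QuotientGroup.rightRel Λ) (f.1 1)).out = f.1 1}

/-- The Haar probability measure `m_Λ` on `Iso(F_d)/Λ`: the Haar measure of `Iso(F_d)`, restricted
to a fundamental domain of `Λ`, rescaled to have mass one and pushed forward to the quotient. -/
noncomputable def haarProb {d : ℕ} (Λ : Subgroup (F d)) : Measure (IsoQuotient Λ) :=
  ((Measure.haar (fundDomain Λ))⁻¹ • Measure.haar.restrict (fundDomain Λ)).map (proj Λ)

/-- The action of `G` on `(X, μ)` is mixing: for all measurable `A` and `B`, the function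
`g ↦ |μ(gA ∩ B) - μ(A) μ(B)|` vanishes at infinity on `G`. -/
def IsMixing (G : Type*) [Group G] [TopologicalSpace G] {X : Type*} [MeasurableSpace X]
    [MulAction G X] (μ : Measure X) : Prop :=
  ∀ A B : Set X, MeasurableSet A → MeasurableSet B → ∀ ε : ℝ, 0 < ε →
    IsCompact {g : G | ε ≤ |μ.real (((fun x => g • x) '' A) ∩ B) - μ.real A * μ.real B|}

/-- Parity of the word length is additive. -/
theorem even_norm_mul {d : ℕ} (x y : F d) : Even (x * y).norm ↔ (Even x.norm ↔ Even y.norm) := by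
  let φ : F d →* Multiplicative (ZMod 2) := FreeGroup.lift fun _ => Multiplicative.ofAdd 1
  have hL : ∀ L : List (Fin d × Bool),
      φ (FreeGroup.mk L) = Multiplicative.ofAdd (L.length : ZMod 2) := by
    intro L
    induction L with
    | nil => exact φ.map_one
    | cons a L ih =>
      have h : FreeGroup.mk (a :: L) = FreeGroup.mk [a] * FreeGroup.mk L := by
        rw [FreeGroup.mul_mk]; rfl
      have h1 : φ (FreeGroup.mk [a]) = Multiplicative.ofAdd (1 : ZMod 2) := by
        rcases a with ⟨a, _ | _⟩
        · simp only [φ, FreeGroup.lift_mk, List.map_cons, List.map_nil, List.prod_singleton]; decide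
        · simp [φ]
      rw [h, map_mul, ih, h1, ← ofAdd_add, List.length_cons]
      push_cast
      rw [add_comm]
  have hφ : ∀ z : F d, φ z = Multiplicative.ofAdd (z.norm : ZMod 2) := by
    intro z
    conv_lhs => rw [← FreeGroup.mk_toWord (x := z)]
    exact hL _
  have h := hφ (x * y)
  rw [map_mul, hφ, hφ, ← ofAdd_add] at h
  have h' : ((x.norm + y.norm : ℕ) : ZMod 2) = ((x * y).norm : ZMod 2) := by
    push_cast
    exact Multiplicative.ofAdd.injective h
  rw [ZMod.natCast_eq_natCast_iff] at h'
  rw [← Nat.even_add, Nat.even_iff, Nat.even_iff]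
  unfold Nat.ModEq at h'
  omega

/-- The even subgroup of `F_d`: the elements of even word length. -/
def evenSubgroup (d : ℕ) : Subgroup (F d) where
  carrier := {γ | Even γ.norm}
  mul_mem' := fun {x y} hx hy => (even_norm_mul x y).2 ⟨fun _ => hy, fun _ => hx⟩
  one_mem' := by simp
  inv_mem' := by
    intro x hx
    simpa using hx

end FreeIso

/-!
The group `Iso(F_d)` is the automorphism group of the `2d`-regular tree, and the theorem is an
instance of the Howe–Moore phenomenon for its index two subgroup of even isometries.

Invariance of `m_Λ`: a right translate of Haar measure is a multiple of Haar measure, and the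
multiple is `1` because a right translate of the fundamental domain of the lattice `Λ` is again a
fundamental domain (`haar_inter_preimage_mul_right`).

If `Λ` contains odd elements, then `Iso(F_d)` is mixing. Let `K_n` be the pointwise stabilizer of
the ball of radius `n ≥ 1` around the root, `V_n` the space of `K_n`-invariant functions of mean zero
on the quotient, which has finite dimension since the quotient is compact, and `P` the orthogonal
projection onto `V_n` for the `L²` inner product. For `γ` in `F_d` consider the
operators `T_γ = P ∘ γ` on `V_n`.

* If `γ δ` is a product without cancellation, then `T_{γδ} = T_γ T_δ`
  (`SmoothFn.exists_projection_mul`). Every element of `K_n` splits into a factor that is supported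
  on the branch containing `δ`, so that it fixes the ball around `γ⁻¹`, and a factor supported off
  that branch, which fixes the ball around `δ`. Hence averaging over `K_n` between `γ` and `δ` does
  not matter.
* If `|γ| = 2n + 3`, then `‖T_γ‖ < 1` (`SmoothFn.eq_zero_of_koopman_mem_level`). Otherwise some
  nonzero `φ` in `V_n` has `γ φ` in `V_n`, so `φ` is fixed by the pointwise stabilizers of two
  disjoint balls. These generate all even isometries (`even_le_of_fixBall`): they contain the
  stabilizers of the edges between the balls, two adjacent edge stabilizers generate a vertex
  stabilizer, and two adjacent vertex stabilizers generate the even isometries. The even isometries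
  act transitively on the quotient as `Λ` is not even, so `φ` is constant, hence zero.

There are finitely many `γ` of length `2n + 3`, so `‖T_γ‖` decays exponentially in `|γ|`
(`exists_inner_le_of_contraction`). As `V_n` is stable under the compact stabilizer of the root,
which together with `F_d` generates `Iso(F_d)`, the matrix coefficients of vectors of `V_n` vanish
at infinity on `Iso(F_d)`. The sets invariant under some `K_n` approximate all measurable sets in
measure (`exists_isSmooth_symmDiff_lt`), and this gives mixing.

Mixing passes to the closed discrete subgroup `F_d`. Finally, if `Λ` is even, then the `[f]` with
`|f(1)|` even form a set of measure one half that is invariant under the infinitely many even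
elements of `F_d`.
-/

namespace FreeIso

variable {d : ℕ}

/-! ### Branches of the Cayley tree -/

/-- The first letter of the reduced word of `γ`, or `none` if `γ = 1`. The fibres over letters are
the branches of the Cayley tree at the root `1`. -/
def head (γ : F d) : Option (Fin d × Bool) := γ.toWord.head?

/-- The element of `F_d` that is given by a letter, that is, a neighbour of `1` in the tree. -/
def letter (x : Fin d × Bool) : F d := FreeGroup.mk [x]

@[simp] theorem norm_letter (x : Fin d × Bool) : (letter x).norm = 1 := by
  simp [letter, FreeGroup.norm]

@[simp] theorem head_letter (x : Fin d × Bool) : head (letter x) = some x := by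
  simp [letter, head]

theorem head_one : head (1 : F d) = none := by simp [head]

theorem head_eq_none {γ : F d} : head γ = none ↔ γ = 1 := by
  simp [head]

theorem letter_inv (x : Fin d × Bool) : (letter x)⁻¹ = letter (x.1, !x.2) := by
  simp [letter, FreeGroup.inv_mk, FreeGroup.invRev]

theorem norm_mk_of_isReduced {w : List (Fin d × Bool)} (h : FreeGroup.IsReduced w) :
    (FreeGroup.mk w : F d).norm = w.length := by
  rw [FreeGroup.norm, FreeGroup.toWord_mk, h.reduce_eq]

theorem exists_letter_of_norm_eq_one {γ : F d} (h : γ.norm = 1) : ∃ x, γ = letter x := by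
  obtain ⟨x, hx⟩ := List.length_eq_one_iff.1 h
  exact ⟨x, by rw [letter, ← hx, FreeGroup.mk_toWord]⟩

/-- The geodesic between points of different branches passes through the root. -/
theorem norm_inv_mul_of_head_ne {γ δ : F d} (h : head γ ≠ head δ) :
    (γ⁻¹ * δ).norm = γ.norm + δ.norm := by
  have hred : FreeGroup.IsReduced (FreeGroup.invRev γ.toWord ++ δ.toWord) := by
    refine List.IsChain.append ?_ FreeGroup.isReduced_toWord ?_
    · rw [← FreeGroup.toWord_inv]
      exact FreeGroup.isReduced_toWord
    · intro a ha b hb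
      simp only [FreeGroup.invRev, List.getLast?_reverse, List.head?_map] at ha
      unfold head at h
      rw [Option.mem_def] at hb
      rw [hb] at h
      cases hγ : γ.toWord.head? with
      | none => simp [hγ] at ha
      | some c =>
        rw [hγ] at h ha
        obtain rfl : (c.1, !c.2) = a := by simpa using ha
        intro h1
        have h2 : c.2 ≠ b.2 := fun h2 => h (congrArg some (Prod.ext h1 h2))
        revert h2
        cases c.2 <;> cases b.2 <;> simp
  have h1 : γ⁻¹ * δ = FreeGroup.mk (FreeGroup.invRev γ.toWord ++ δ.toWord) := by
    rw [← FreeGroup.mul_mk, ← FreeGroup.inv_mk, FreeGroup.mk_toWord, FreeGroup.mk_toWord]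
  rw [h1, norm_mk_of_isReduced hred, List.length_append, FreeGroup.invRev_length]
  rfl

theorem exists_eq_letter_mul {γ : F d} {x : Fin d × Bool} (h : head γ = some x) :
    ∃ δ : F d, γ = letter x * δ ∧ γ.norm = δ.norm + 1 := by
  obtain ⟨w, hw⟩ := List.head?_eq_some_iff.1 h
  have hr : FreeGroup.IsReduced w :=
    (FreeGroup.isReduced_toWord (x := γ)).infix (hw ▸ List.infix_cons (List.infix_refl w))
  refine ⟨FreeGroup.mk w, ?_, ?_⟩
  · rw [letter, FreeGroup.mul_mk, List.singleton_append, ← hw, FreeGroup.mk_toWord]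
  · rw [norm_mk_of_isReduced hr, FreeGroup.norm, hw, List.length_cons]

/-- A point lies in the branch at a letter iff it is closer to that letter than to the root. -/
theorem head_eq_some_iff {γ : F d} {x : Fin d × Bool} :
    head γ = some x ↔ ((letter x)⁻¹ * γ).norm < γ.norm := by
  constructor
  · intro h
    obtain ⟨δ, rfl, hn⟩ := exists_eq_letter_mul h
    rw [hn, inv_mul_cancel_left]
    exact Nat.lt_succ_self _
  · intro h
    by_contra hne
    rw [norm_inv_mul_of_head_ne (by rw [head_letter]; exact Ne.symm hne)] at h
    omega

/-- There is no cancellation between `α` and `δ` only if the geodesics from the root to `α⁻¹` and to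
`δ` leave it in different directions. -/
theorem head_inv_ne_of_norm_mul {α δ : F d} {x : Fin d × Bool}
    (hn : (α * δ).norm = α.norm + δ.norm) (hδ : head δ = some x) : head α⁻¹ ≠ some x := by
  intro hα
  obtain ⟨α', hα, hαn⟩ := exists_eq_letter_mul hα
  obtain ⟨δ', rfl, hδn⟩ := exists_eq_letter_mul hδ
  rw [FreeGroup.norm_inv_eq] at hαn
  obtain rfl : α = α'⁻¹ * (letter x)⁻¹ := by rw [← inv_inv α, hα, mul_inv_rev]
  have h : α'⁻¹ * (letter x)⁻¹ * (letter x * δ') = α'⁻¹ * δ' := by group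
  have h' := FreeGroup.norm_mul_le α'⁻¹ δ'
  rw [h] at hn
  rw [FreeGroup.norm_inv_eq] at h'
  omega

theorem exists_mul_of_le_norm {γ : F d} {m : ℕ} (h : m ≤ γ.norm) :
    ∃ α β : F d, γ = α * β ∧ α.norm = m ∧ γ.norm = α.norm + β.norm := by
  have hr := FreeGroup.isReduced_toWord (x := γ)
  have e := List.take_append_drop m γ.toWord
  have h1 : FreeGroup.IsReduced (γ.toWord.take m) := hr.infix (List.take_prefix m _).isInfix
  have h2 : FreeGroup.IsReduced (γ.toWord.drop m) := hr.infix (List.drop_suffix m _).isInfix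
  refine ⟨FreeGroup.mk (γ.toWord.take m), FreeGroup.mk (γ.toWord.drop m), ?_, ?_, ?_⟩
  · rw [FreeGroup.mul_mk, e, FreeGroup.mk_toWord]
  · rw [norm_mk_of_isReduced h1, List.length_take]
    exact min_eq_left h
  · rw [norm_mk_of_isReduced h1, norm_mk_of_isReduced h2, ← List.length_append, e]
    rfl

/-! ### Isometries fixing the root -/

theorem norm_apply {g : Iso d} (hg : g.1 1 = 1) (γ : F d) : (g.1 γ).norm = γ.norm := by
  simpa [hg] using g.2 1 γ

theorem exists_apply_letter {g : Iso d} (hg : g.1 1 = 1) (x : Fin d × Bool) :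
    ∃ y, g.1 (letter x) = letter y :=
  exists_letter_of_norm_eq_one (by rw [norm_apply hg, norm_letter])

theorem head_apply_eq_some_iff {g : Iso d} (hg : g.1 1 = 1) {x y : Fin d × Bool}
    (hxy : g.1 (letter x) = letter y) (γ : F d) : head (g.1 γ) = some y ↔ head γ = some x := by
  rw [head_eq_some_iff, head_eq_some_iff, ← hxy, g.2, norm_apply hg]

theorem letter_injective : Function.Injective (letter (d := d)) := by
  intro x y h
  simpa using congrArg head h

/-- Cutting and pasting: an isometry that fixes the root and preserves a union of branches can be
replaced by the identity off that union. -/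
theorem exists_glue (g : Iso d) (hg : g.1 1 = 1) (A : Set (Option (Fin d × Bool)))
    (hA : ∀ γ, head (g.1 γ) ∈ A ↔ head γ ∈ A) :
    ∃ u : Iso d, (∀ γ, head γ ∈ A → u.1 γ = g.1 γ) ∧ ∀ γ, head γ ∉ A → u.1 γ = γ := by
  classical
  have hA' : ∀ γ, head (g.1.symm γ) ∈ A ↔ head γ ∈ A := fun γ => by
    rw [← hA, Equiv.apply_symm_apply]
  let e : Equiv.Perm (F d) :=
    { toFun := fun γ => if head γ ∈ A then g.1 γ else γ
      invFun := fun γ => if head γ ∈ A then g.1.symm γ else γ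
      left_inv := fun γ => by
        by_cases h : head γ ∈ A
        · simp [h, hA]
        · simp [h]
      right_inv := fun γ => by
        by_cases h : head γ ∈ A
        · simp [h, hA']
        · simp [h] }
  have he1 : ∀ γ, head γ ∈ A → e γ = g.1 γ := fun γ h => if_pos h
  have he2 : ∀ γ, head γ ∉ A → e γ = γ := fun γ h => if_neg h
  have key : ∀ γ δ, head γ ∈ A → head δ ∉ A → ((g.1 γ)⁻¹ * δ).norm = (γ⁻¹ * δ).norm := by
    intro γ δ hγ hδ
    rw [norm_inv_mul_of_head_ne, norm_inv_mul_of_head_ne, norm_apply hg]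
    · exact fun h => hδ (h ▸ hγ)
    · exact fun h => hδ (h ▸ (hA γ).2 hγ)
  have hsymm : ∀ γ δ : F d, (γ⁻¹ * δ).norm = (δ⁻¹ * γ).norm := fun γ δ => by
    rw [← FreeGroup.norm_inv_eq, mul_inv_rev, inv_inv]
  refine ⟨⟨e, fun γ δ => ?_⟩, he1, he2⟩
  by_cases hγ : head γ ∈ A <;> by_cases hδ : head δ ∈ A
  · rw [he1 γ hγ, he1 δ hδ, g.2]
  · rw [he1 γ hγ, he2 δ hδ, key γ δ hγ hδ]
  · rw [he2 γ hγ, he1 δ hδ, hsymm, key δ γ hδ hγ, hsymm]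
  · rw [he2 γ hγ, he2 δ hδ]

/-- An isometry that fixes an edge at the root is the product of an isometry supported on the branch
beyond that edge and one supported on the complement. -/
theorem exists_split (g : Iso d) (hg : g.1 1 = 1) (x : Fin d × Bool)
    (hx : g.1 (letter x) = letter x) :
    ∃ a b : Iso d, g = a * b ∧ (∀ γ, head γ ≠ some x → a.1 γ = γ) ∧
      (∀ γ, head γ = some x → a.1 γ = g.1 γ) ∧
      (∀ γ, head γ = some x → b.1 γ = γ) ∧ (∀ γ, head γ ≠ some x → b.1 γ = g.1 γ) := by
  have h := head_apply_eq_some_iff hg hx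
  obtain ⟨a, ha1, ha2⟩ := exists_glue g hg {some x} (by simpa using h)
  obtain ⟨b, hb1, hb2⟩ := exists_glue g hg {some x}ᶜ (by simpa using fun γ => not_congr (h γ))
  refine ⟨a, b, ?_, fun γ hγ => ha2 γ (by simpa using hγ), fun γ hγ => ha1 γ (by simpa using hγ),
    fun γ hγ => hb2 γ (by simpa using hγ), fun γ hγ => hb1 γ (by simpa using hγ)⟩
  ext1
  ext1 γ
  change g.1 γ = a.1 (b.1 γ)
  by_cases hγ : head γ = some x
  · rw [hb2 γ (by simpa using hγ), ha1 γ (by simpa using hγ)]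
  · rw [hb1 γ (by simpa using hγ), ha2 _ (by simpa [h] using hγ)]

theorem norm_lift_le (θ : F d →* F d) (hθ : ∀ i, (θ (FreeGroup.of i)).norm ≤ 1) (γ : F d) :
    (θ γ).norm ≤ γ.norm := by
  have key : ∀ w : List (Fin d × Bool), (θ (FreeGroup.mk w)).norm ≤ w.length := by
    intro w
    induction w with
    | nil => simp [← FreeGroup.one_eq_mk]
    | cons a w ih =>
      have h1 : (θ (FreeGroup.mk [a])).norm ≤ 1 := by
        rcases a with ⟨i, _ | _⟩
        · have : (FreeGroup.mk [(i, false)] : F d) = (FreeGroup.of i)⁻¹ := by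
            simp [FreeGroup.of, FreeGroup.inv_mk, FreeGroup.invRev]
          rw [this, map_inv, FreeGroup.norm_inv_eq]
          exact hθ i
        · exact hθ i
      have h : (FreeGroup.mk (a :: w) : F d) = FreeGroup.mk [a] * FreeGroup.mk w := by
        rw [FreeGroup.mul_mk]; rfl
      rw [h, map_mul, List.length_cons]
      have := FreeGroup.norm_mul_le (θ (FreeGroup.mk [a])) (θ (FreeGroup.mk w))
      omega
  have := key γ.toWord
  rwa [FreeGroup.mk_toWord] at this

/-- Any two neighbours of the root are interchanged by an involutive automorphism of `F_d` that
permutes the generators and their inverses. -/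
theorem exists_swap (x y : Fin d × Bool) : ∃ g : Iso d, g.1 1 = 1 ∧ (∀ γ, g.1 (g.1 γ) = γ) ∧
    g.1 (letter x) = letter y ∧ g.1 (letter y) = letter x := by
  obtain ⟨i, b⟩ := x
  obtain ⟨j, c⟩ := y
  have hl : ∀ k : Fin d, ∀ e : Bool, letter (k, e) =
      if e = true then FreeGroup.of k else (FreeGroup.of k)⁻¹ := by
    rintro k (_ | _)
    · simp [letter, FreeGroup.of, FreeGroup.inv_mk, FreeGroup.invRev]
    · rfl
  by_cases hxy : i = j ∧ b = c
  · obtain ⟨rfl, rfl⟩ := hxy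
    exact ⟨1, rfl, fun _ => rfl, rfl, rfl⟩
  let θ : F d →* F d := FreeGroup.lift fun k =>
    if k = i then (if b = true then letter (j, c) else (letter (j, c))⁻¹)
    else if k = j then (if c = true then letter (i, b) else (letter (i, b))⁻¹) else FreeGroup.of k
  have hθ : ∀ k, θ (FreeGroup.of k) =
    if k = i then (if b = true then letter (j, c) else (letter (j, c))⁻¹)
    else if k = j then (if c = true then letter (i, b) else (letter (i, b))⁻¹)
    else FreeGroup.of k := fun k => FreeGroup.lift_apply_of
  have h1 : ∀ γ, (θ γ).norm ≤ γ.norm := norm_lift_le θ fun k => by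
    rw [hθ]
    split_ifs <;> simp
  have hx : θ (letter (i, b)) = letter (j, c) := by
    have := hθ i
    rw [if_pos rfl] at this
    rw [hl i b]
    cases b <;> simp [this]
  have hy : θ (letter (j, c)) = letter (i, b) := by
    have := hθ j
    by_cases hij : j = i
    · subst hij
      have hbc : b ≠ c := fun h => hxy ⟨rfl, h⟩
      cases b <;> cases c <;> simp_all
    · rw [if_neg hij, if_pos rfl] at this
      rw [hl j c]
      cases c <;> simp [this]
  have hinv : ∀ γ, θ (θ γ) = γ := by
    have : θ.comp θ = MonoidHom.id _ := by
      refine FreeGroup.ext_hom _ _ fun k => ?_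
      rw [MonoidHom.comp_apply, MonoidHom.id_apply, hθ k]
      split_ifs with h2 h3 h4 h5
      · rw [hy, hl, if_pos h3, h2]
      · rw [map_inv, hy, hl, if_neg h3, inv_inv, h2]
      · rw [hx, hl, if_pos h5, h4]
      · rw [map_inv, hx, hl, if_neg h5, inv_inv, h4]
      · rw [hθ, if_neg h2, if_neg h4]
    exact fun γ => DFunLike.congr_fun this γ
  have hn : ∀ γ, (θ γ).norm = γ.norm := fun γ =>
    le_antisymm (h1 γ) (by simpa [hinv] using h1 (θ γ))
  exact ⟨⟨⟨θ, θ, hinv, hinv⟩, fun γ δ => by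
    change ((θ γ)⁻¹ * θ δ).norm = _
    rw [← map_inv, ← map_mul, hn]⟩, map_one θ, hinv, hx, hy⟩

/-- An isometry that interchanges two branches at the root and is the identity elsewhere. -/
theorem exists_swap_fix (x y : Fin d × Bool) : ∃ g : Iso d, g.1 1 = 1 ∧
    g.1 (letter x) = letter y ∧ ∀ z, z ≠ x → z ≠ y → g.1 (letter z) = letter z := by
  obtain ⟨g, hg, -, hx, hy⟩ := exists_swap x y
  obtain ⟨u, hu1, hu2⟩ := exists_glue g hg {some x, some y} (fun γ => by
    simp only [Set.mem_insert_iff, Set.mem_singleton_iff, head_apply_eq_some_iff hg hx,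
      head_apply_eq_some_iff hg hy]
    exact or_comm)
  refine ⟨u, hu2 1 (by simp [head_one]), ?_, fun z hzx hzy => hu2 _ (by simp [hzx, hzy])⟩
  rw [hu1 _ (by simp), hx]

/-! ### Ball stabilizers and the even isometries -/

/-- The pointwise stabilizer of the ball of radius `n` around `c`. -/
def fixBall (c : F d) (n : ℕ) : Subgroup (Iso d) where
  carrier := {g | ∀ γ, (c⁻¹ * γ).norm ≤ n → g.1 γ = γ}
  mul_mem' := fun {g h} hg hh γ hγ => by
    change g.1 (h.1 γ) = γ
    rw [hh γ hγ, hg γ hγ]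
  one_mem' := fun γ _ => rfl
  inv_mem' := fun {g} hg γ hγ => by
    change g.1.symm γ = γ
    rw [Equiv.symm_apply_eq, hg γ hγ]

theorem mem_fixBall {c : F d} {n : ℕ} {g : Iso d} :
    g ∈ fixBall c n ↔ ∀ γ, (c⁻¹ * γ).norm ≤ n → g.1 γ = γ := Iff.rfl

theorem mem_fixBall_one {n : ℕ} {g : Iso d} :
    g ∈ fixBall 1 n ↔ ∀ γ, γ.norm ≤ n → g.1 γ = γ := by
  simp [mem_fixBall]

theorem fixBall_anti {c : F d} {m n : ℕ} (h : m ≤ n) : fixBall c n ≤ fixBall c m :=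
  fun _ hg γ hγ => hg γ (hγ.trans h)

theorem apply_one_of_mem_fixBall {n : ℕ} {g : Iso d} (hg : g ∈ fixBall 1 n) : g.1 1 = 1 :=
  hg 1 (by simp)

theorem conj_mem_fixBall {c : F d} {n : ℕ} {g h : Iso d} (hg : g ∈ fixBall c n) :
    h * g * h⁻¹ ∈ fixBall (h.1 c) n := by
  intro γ hγ
  change h.1 (g.1 (h.1.symm γ)) = γ
  rw [hg, Equiv.apply_symm_apply]
  have := h.2 c (h.1.symm γ)
  rw [Equiv.apply_symm_apply] at this
  rwa [← this]

/-- An isometry preserves or exchanges the two classes of the bipartition of the tree by parity,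
according to the parity of the image of the root. -/
theorem even_norm_apply {g : Iso d} (γ : F d) :
    Even (g.1 γ).norm ↔ (Even (g.1 1).norm ↔ Even γ.norm) := by
  have h := even_norm_mul (g.1 1) ((g.1 1)⁻¹ * g.1 γ)
  rw [g.2, mul_inv_cancel_left] at h
  simpa using h

theorem leftMul_apply (p γ : F d) : (leftMul d p).1 γ = p * γ := rfl

theorem leftMul_inv_apply (p γ : F d) : ((leftMul d p)⁻¹).1 γ = p⁻¹ * γ := by
  rw [← map_inv, leftMul_apply]

theorem mul_apply (g h : Iso d) (γ : F d) : (g * h).1 γ = g.1 (h.1 γ) := rfl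

/-- The stabilizers of two distinct edges at a vertex generate the stabilizer of the vertex: the
latter acts on its at least three neighbours as a full symmetric group, in which point stabilizers
are maximal. -/
theorem stabilizer_le_of_two_edges (hd : 2 ≤ d) (S : Subgroup (Iso d)) {x y : Fin d × Bool}
    (hxy : x ≠ y) (hx : ∀ g : Iso d, g.1 1 = 1 → g.1 (letter x) = letter x → g ∈ S)
    (hy : ∀ g : Iso d, g.1 1 = 1 → g.1 (letter y) = letter y → g ∈ S) {g : Iso d}
    (hg : g.1 1 = 1) : g ∈ S := by
  have main : ∀ k : Iso d, k.1 1 = 1 → k.1 (letter x) ≠ letter y → k ∈ S := by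
    intro k hk hky
    obtain ⟨z, hz⟩ := exists_apply_letter hk x
    by_cases hzx : z = x
    · exact hx k hk (hzx ▸ hz)
    obtain ⟨u, hu1, huz, hu⟩ := exists_swap_fix z x
    have huS : u ∈ S := hy u hu1 (hu y (fun h => hky (h ▸ hz)) hxy.symm)
    have : u * k ∈ S := hx _ (by rw [mul_apply, hk, hu1]) (by rw [mul_apply, hz, huz])
    exact (S.mul_mem_cancel_left huS).1 this
  by_cases hgy : g.1 (letter x) = letter y
  · obtain ⟨z, hzx, hzy⟩ : ∃ z : Fin d × Bool, z ≠ x ∧ z ≠ y := by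
      have hc : ({x, y} : Finset (Fin d × Bool)).card < Fintype.card (Fin d × Bool) := by
        refine (Finset.card_le_two).trans_lt ?_
        simp
        omega
      obtain ⟨z, hz⟩ := Finset.exists_mem_notMem_of_card_lt_card
        (s := ({x, y} : Finset (Fin d × Bool))) (t := Finset.univ) hc
      exact ⟨z, by simpa using hz.2⟩
    obtain ⟨u, hu1, huy, hu⟩ := exists_swap_fix y z
    have huS : u ∈ S := hx u hu1 (hu x hxy hzx.symm)
    refine (S.mul_mem_cancel_left huS).1 (main _ (by rw [mul_apply, hg, hu1]) ?_)
    rw [mul_apply, hgy, huy]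
    exact fun h => hzy (letter_injective h)
  · exact main g hg hgy

/-- If `S` contains the pointwise stabilizers of two balls that lie on different sides of an edge
at the root, then it contains the stabilizer of that edge. -/
theorem edge_stabilizer_le (S : Subgroup (Iso d)) {c₁ c₂ : F d} {n : ℕ} {x : Fin d × Bool}
    (h₁ : fixBall c₁ n ≤ S) (h₂ : fixBall c₂ n ≤ S) (hx₁ : head c₁ = some x)
    (hx₂ : head c₂ ≠ some x) (hn₁ : n < c₁.norm) (hn₂ : n < c₂.norm) {g : Iso d} (hg : g.1 1 = 1)
    (hgx : g.1 (letter x) = letter x) : g ∈ S := by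
  obtain ⟨a, b, rfl, ha, -, hb, -⟩ := exists_split g hg x hgx
  refine S.mul_mem (h₂ fun γ hγ => ha γ fun h => ?_) (h₁ fun γ hγ => hb γ ?_)
  · rw [norm_inv_mul_of_head_ne (by rw [h]; exact hx₂)] at hγ
    omega
  · by_contra h
    rw [norm_inv_mul_of_head_ne (by rw [hx₁]; exact Ne.symm h)] at hγ
    omega

theorem stabilizer_le_of_fixBall_one (hd : 2 ≤ d) (S : Subgroup (Iso d)) {c₁ c₂ : F d} {n : ℕ}
    {x y : Fin d × Bool} (h₁ : fixBall c₁ n ≤ S) (h₂ : fixBall c₂ n ≤ S) (hx : head c₁ = some x)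
    (hy : head c₂ = some y) (hxy : x ≠ y) (hn₁ : n < c₁.norm) (hn₂ : n < c₂.norm) {g : Iso d}
    (hg : g.1 1 = 1) : g ∈ S := by
  refine stabilizer_le_of_two_edges hd S hxy
    (fun k hk hkx => edge_stabilizer_le S h₁ h₂ hx ?_ hn₁ hn₂ hk hkx)
    (fun k hk hkx => edge_stabilizer_le S h₂ h₁ hy ?_ hn₂ hn₁ hk hkx) hg
  · rw [hy]
    exact fun h => hxy (Option.some_injective _ h).symm
  · rw [hx]
    exact fun h => hxy (Option.some_injective _ h)

/-- The conjugate `p⁻¹ S p`, whose geometry at the root is that of `S` at `p`. -/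
def recenter (S : Subgroup (Iso d)) (p : F d) : Subgroup (Iso d) :=
  S.comap (MulAut.conj (leftMul d p)).toMonoidHom

theorem mem_recenter {S : Subgroup (Iso d)} {p : F d} {g : Iso d} :
    g ∈ recenter S p ↔ leftMul d p * g * (leftMul d p)⁻¹ ∈ S := Iff.rfl

theorem inv_conj_mem_recenter {S : Subgroup (Iso d)} {p : F d} {g : Iso d} :
    (leftMul d p)⁻¹ * g * leftMul d p ∈ recenter S p ↔ g ∈ S := by
  rw [mem_recenter]
  simp [mul_assoc]

theorem fixBall_le_recenter {S : Subgroup (Iso d)} {c : F d} {n : ℕ} (h : fixBall c n ≤ S)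
    (p : F d) : fixBall (p⁻¹ * c) n ≤ recenter S p := by
  intro g hg
  have := conj_mem_fixBall (h := leftMul d p) hg
  rw [leftMul_apply, mul_inv_cancel_left] at this
  exact h this

/-- The stabilizers of the root and of one neighbour generate all even isometries. -/
theorem even_le_of_stabilizers (S : Subgroup (Iso d)) (x : Fin d × Bool)
    (h₁ : ∀ g : Iso d, g.1 1 = 1 → g ∈ S)
    (h₂ : ∀ g : Iso d, g.1 (letter x) = letter x → g ∈ S) {g : Iso d}
    (hg : Even (g.1 1).norm) : g ∈ S := by
  obtain ⟨m, hm⟩ := hg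
  induction m generalizing g with
  | zero => exact h₁ g (FreeGroup.norm_eq_zero.1 hm)
  | succ m ih =>
    -- rotate about the root so that `g 1` enters the branch at `x`
    obtain ⟨y, hy⟩ : ∃ y, head (g.1 1) = some y := by
      rw [← Option.ne_none_iff_exists', Ne, head_eq_none, ← FreeGroup.norm_eq_zero]
      omega
    obtain ⟨k, hk1, -, hky, -⟩ := exists_swap y x
    have hhead : head (k.1 (g.1 1)) = some x := (head_apply_eq_some_iff hk1 hky _).2 hy
    obtain ⟨δ, hδ, hδn⟩ := exists_eq_letter_mul hhead
    rw [norm_apply hk1] at hδn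
    obtain ⟨z, hz⟩ : ∃ z, head δ = some z := by
      rw [← Option.ne_none_iff_exists', Ne, head_eq_none, ← FreeGroup.norm_eq_zero]
      omega
    -- rotate about `x` by a half turn that takes the geodesic from `x` to `k (g 1)` through `1`
    obtain ⟨u, hu1, -, huz, -⟩ := exists_swap z (x.1, !x.2)
    set h : Iso d := leftMul d (letter x) * u * (leftMul d (letter x))⁻¹
    have hhS : h ∈ S := by
      refine h₂ h ?_
      change letter x * u.1 (((leftMul d (letter x))⁻¹).1 (letter x)) = letter x
      rw [leftMul_inv_apply, inv_mul_cancel, hu1, mul_one]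
    have hhkg : ((h * (k * g)).1 1).norm = m + m := by
      change (letter x * u.1 (((leftMul d (letter x))⁻¹).1 (k.1 (g.1 1)))).norm = _
      rw [leftMul_inv_apply, hδ, inv_mul_cancel_left]
      have h3 : head (u.1 δ) = some (x.1, !x.2) := (head_apply_eq_some_iff hu1 huz δ).2 hz
      obtain ⟨ε, hε, hεn⟩ := exists_eq_letter_mul h3
      rw [norm_apply hu1] at hεn
      rw [hε, ← letter_inv, mul_inv_cancel_left]
      omega
    exact (S.mul_mem_cancel_left (h₁ k hk1)).1 ((S.mul_mem_cancel_left hhS).1 (ih hhkg))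

/-- The pointwise stabilizers of two sufficiently distant balls generate all even isometries. -/
theorem even_le_of_fixBall (hd : 2 ≤ d) (S : Subgroup (Iso d)) {η : F d} {n : ℕ}
    (hη : η.norm = 2 * n + 3) (h₁ : fixBall 1 n ≤ S) (h₂ : fixBall η n ≤ S) {g : Iso d}
    (hg : Even (g.1 1).norm) : g ∈ S := by
  -- split the geodesic from `1` to `η` around its two inner vertices `p` and `p * letter x`
  obtain ⟨p, β, rfl, hp, hpβ⟩ := exists_mul_of_le_norm (γ := η) (m := n + 1) (by omega)
  have exists_head : ∀ {α : F d}, 0 < α.norm → ∃ a, head α = some a := by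
    intro α hα
    rw [← Option.ne_none_iff_exists', Ne, head_eq_none, ← FreeGroup.norm_eq_zero]
    omega
  have key : ∀ q δ : F d, q * δ = p * β → (p * β).norm = q.norm + δ.norm → n < q.norm →
      n < δ.norm → ∀ k : Iso d, k.1 1 = 1 → k ∈ recenter S q := by
    intro q δ hqδ hn hq hδ k hk
    obtain ⟨a, ha⟩ := exists_head (α := q⁻¹) (by rw [FreeGroup.norm_inv_eq]; omega)
    obtain ⟨b, hb⟩ := exists_head (α := δ) (by omega)
    have e1 := fixBall_le_recenter h₁ q
    have e2 := fixBall_le_recenter h₂ q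
    rw [mul_one] at e1
    rw [← hqδ, inv_mul_cancel_left] at e2
    exact stabilizer_le_of_fixBall_one hd _ e1 e2 ha hb
      (fun h => head_inv_ne_of_norm_mul (by rw [hqδ, hn]) hb (h ▸ ha))
      (by rw [FreeGroup.norm_inv_eq]; omega) hδ hk
  obtain ⟨x, hx⟩ := exists_head (α := β) (by omega)
  obtain ⟨δ, rfl, hδ⟩ := exists_eq_letter_mul hx
  have hpx : (p * letter x).norm = n + 2 := by
    have e1 := FreeGroup.norm_mul_le p (letter x)
    have e2 := FreeGroup.norm_mul_le (p * letter x) δ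
    rw [mul_assoc] at e2
    rw [norm_letter] at e1
    omega
  have k1 := key p (letter x * δ) rfl hpβ (by omega) (by omega)
  have k2 := key (p * letter x) δ (mul_assoc _ _ _) (by omega) (by omega) (by omega)
  rw [← inv_conj_mem_recenter (p := p)]
  refine even_le_of_stabilizers _ x k1 (fun k hk => ?_) ?_
  · have := k2 ((leftMul d (letter x))⁻¹ * k * leftMul d (letter x)) (by
      rw [mul_apply, mul_apply, leftMul_apply, leftMul_inv_apply, mul_one, hk, inv_mul_cancel])
    rw [mem_recenter] at this ⊢
    rw [map_mul] at this
    convert this using 1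
    group
  · rw [mul_apply, mul_apply, leftMul_apply, leftMul_inv_apply, mul_one, even_norm_mul,
      even_norm_apply, FreeGroup.norm_inv_eq]
    tauto

/-- An isometry that fixes a ball around the root, a point on the geodesic from `γ⁻¹` to `δ`, is the
product of isometries that fix the balls of the same radius around `γ⁻¹` and around `δ`. -/
theorem exists_split_fixBall {n : ℕ} (hn : 1 ≤ n) {γ δ : F d}
    (h : (γ * δ).norm = γ.norm + δ.norm) {k : Iso d} (hk : k ∈ fixBall 1 n) :
    ∃ a ∈ fixBall γ⁻¹ n, ∃ b ∈ fixBall δ n, k = a * b := by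
  have hk' := mem_fixBall_one.1 hk
  cases hδ : head δ with
  | none =>
    rw [head_eq_none] at hδ
    exact ⟨1, one_mem _, k, hδ ▸ hk, (one_mul k).symm⟩
  | some x =>
    have hγ := head_inv_ne_of_norm_mul h hδ
    obtain ⟨a, b, hab, ha1, ha2, hb1, hb2⟩ := exists_split k (apply_one_of_mem_fixBall hk) x
      (hk' _ (by rwa [norm_letter]))
    refine ⟨a, fun τ hτ => ?_, b, fun τ hτ => ?_, hab⟩
    · by_cases hx : head τ = some x
      · rw [norm_inv_mul_of_head_ne (by rw [hx]; exact hγ)] at hτ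
        rw [ha2 τ hx, hk' τ (by omega)]
      · exact ha1 τ hx
    · by_cases hx : head τ = some x
      · exact hb1 τ hx
      · rw [norm_inv_mul_of_head_ne (by rw [hδ]; exact Ne.symm hx)] at hτ
        rw [hb2 τ hx, hk' τ (by omega)]

/-! ### Topology of `Iso(F_d)` -/

instance : SecondCountableTopology (Iso d) :=
  Topology.IsInducing.secondCountableTopology (f := fun (f : Iso d) (γ : F d) => f.1 γ) ⟨rfl⟩

theorem isOpen_fixBall (n : ℕ) : IsOpen (fixBall (1 : F d) n : Set (Iso d)) := by
  have : (fixBall (1 : F d) n : Set (Iso d)) = ⋂ γ ∈ {γ : F d | γ.norm ≤ n}, {f | f.1 γ = γ} := by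
    ext f
    simp [mem_fixBall_one]
  rw [this]
  exact (finite_norm_le d n).isOpen_biInter fun γ _ => isOpen_eval γ γ

theorem isOpen_leftCoset (f : Iso d) (n : ℕ) : IsOpen {h : Iso d | f⁻¹ * h ∈ fixBall 1 n} :=
  (isOpen_fixBall n).preimage (continuous_const_mul f⁻¹)

/-- The pointwise stabilizers of balls around the root form a basis of neighbourhoods of `1`. -/
theorem exists_fixBall_of_isOpen {S : Set (Iso d)} (hS : IsOpen S) {f : Iso d} (hf : f ∈ S) :
    ∃ n, ∀ k ∈ fixBall 1 n, f * k ∈ S := by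
  obtain ⟨t, ht, hts⟩ := (mem_nhds_induced _ f S).1 (hS.mem_nhds hf)
  rw [nhds_pi, Filter.mem_pi] at ht
  obtain ⟨I, hI, t', ht', hsub⟩ := ht
  refine ⟨hI.toFinset.sup FreeGroup.norm, fun k hk => hts (hsub fun γ hγ => ?_)⟩
  have hkγ : k.1 γ = γ := mem_fixBall_one.1 hk γ (Finset.le_sup (hI.mem_toFinset.2 hγ))
  change f.1 (k.1 γ) ∈ t' γ
  rw [hkγ]
  exact mem_of_mem_nhds (ht' γ)

theorem isOpen_of_right_invariant {S : Set (Iso d)} {n : ℕ}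
    (hS : ∀ f ∈ S, ∀ k ∈ fixBall 1 n, f * k ∈ S) : IsOpen S := by
  refine isOpen_iff_mem_nhds.2 fun f hf => ?_
  filter_upwards [(isOpen_leftCoset f n).mem_nhds (x := f) (by simp)] with h hh
  have := hS f hf _ hh
  rwa [mul_inv_cancel_left] at this

theorem exists_finite_cover {C : Set (Iso d)} (hC : IsCompact C) (n : ℕ) :
    ∃ R : Finset (Iso d), ∀ f ∈ C, ∃ r ∈ R, r⁻¹ * f ∈ fixBall 1 n := by
  obtain ⟨R, hR⟩ := hC.elim_finite_subcover (fun r : Iso d => {h | r⁻¹ * h ∈ fixBall 1 n})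
    (fun r => isOpen_leftCoset r n) fun f _ => Set.mem_iUnion.2 ⟨f, by simp⟩
  exact ⟨R, fun f hf => by simpa using hR hf⟩

theorem isCompact_norm_apply_one_le (n : ℕ) : IsCompact {f : Iso d | (f.1 1).norm ≤ n} := by
  have : {f : Iso d | (f.1 1).norm ≤ n} =
      ⋃ γ ∈ {γ : F d | γ.norm ≤ n}, (fun f => leftMul d γ * f) '' {f : Iso d | f.1 1 = 1} := by
    ext f
    simp only [Set.mem_ofPred_eq, Set.mem_iUnion, Set.mem_image, exists_prop]
    constructor
    · intro hf
      refine ⟨f.1 1, hf, (leftMul d (f.1 1))⁻¹ * f, ?_, mul_inv_cancel_left _ _⟩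
      rw [mul_apply, leftMul_inv_apply, inv_mul_cancel]
    · rintro ⟨γ, hγ, k, hk, rfl⟩
      rwa [mul_apply, hk, leftMul_apply, mul_one]
  rw [this]
  exact (finite_norm_le d n).isCompact_biUnion fun γ _ =>
    (isCompact_stabilizer d).image (continuous_const_mul _)

/-! ### The quotient and its fundamental domain -/

variable {Λ : Subgroup (F d)}

theorem proj_eq_proj {f f' : Iso d} : proj Λ f = proj Λ f' ↔ ∃ γ ∈ Λ, leftMul d γ * f' = f := by
  refine Quotient.eq.trans ((MulAction.orbitRel_apply).trans ?_)
  constructor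
  · rintro ⟨⟨_, γ, hγ, rfl⟩, h⟩
    exact ⟨γ, hγ, h⟩
  · rintro ⟨γ, hγ, h⟩
    exact ⟨⟨_, γ, hγ, rfl⟩, h⟩

theorem proj_surjective : Function.Surjective (proj Λ) := Quotient.mk_surjective

theorem smul_proj (g f : Iso d) : g • proj Λ f = proj Λ (f * g⁻¹) := rfl

theorem smul_def_leftMul (γ : F d) (x : IsoQuotient Λ) : γ • x = leftMul d γ • x := rfl

theorem measurable_proj : Measurable (proj Λ) := fun _ h => h

theorem measurableSet_iff_preimage {A : Set (IsoQuotient Λ)} :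
    MeasurableSet A ↔ MeasurableSet (proj Λ ⁻¹' A) := Iff.rfl

theorem measurable_smul_quotient (g : Iso d) : Measurable fun x : IsoQuotient Λ => g • x := by
  intro A hA
  exact measurable_mul_const g⁻¹ (measurableSet_iff_preimage.1 hA)

theorem mem_fundDomain {f : Iso d} : f ∈ fundDomain Λ ↔
    (Quotient.mk (QuotientGroup.rightRel Λ) (f.1 1)).out = f.1 1 := Iff.rfl

theorem mul_mem_fundDomain_iff {f k : Iso d} (hk : k.1 1 = 1) :
    f * k ∈ fundDomain Λ ↔ f ∈ fundDomain Λ := by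
  rw [mem_fundDomain, mem_fundDomain, mul_apply, hk]

theorem isOpen_fundDomain : IsOpen (fundDomain Λ) :=
  isOpen_of_right_invariant (n := 0) fun _ hf _ hk =>
    (mul_mem_fundDomain_iff (apply_one_of_mem_fixBall hk)).2 hf

/-- Every `Λ`-orbit meets the fundamental domain in exactly one point, and `Λ` acts freely. -/
theorem existsUnique_mem_fundDomain (f : Iso d) :
    ∃ γ ∈ Λ, leftMul d γ * f ∈ fundDomain Λ ∧
      ∀ δ ∈ Λ, leftMul d δ * f ∈ fundDomain Λ → δ = γ := by
  have hmk : ∀ γ ∈ Λ, Quotient.mk (QuotientGroup.rightRel Λ) (γ * f.1 1) =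
      Quotient.mk (QuotientGroup.rightRel Λ) (f.1 1) := fun γ hγ =>
    Quotient.sound (QuotientGroup.rightRel_apply.2 (by simpa using Λ.inv_mem hγ))
  set t := (Quotient.mk (QuotientGroup.rightRel Λ) (f.1 1)).out with ht
  have htΛ : t * (f.1 1)⁻¹ ∈ Λ := by
    have := Quotient.mk_out (s := QuotientGroup.rightRel Λ) (f.1 1)
    have h2 := QuotientGroup.rightRel_apply.1 this
    simpa using Λ.inv_mem h2
  refine ⟨t * (f.1 1)⁻¹, htΛ, ?_, fun δ hδ hδf => ?_⟩
  · rw [mem_fundDomain, mul_apply, leftMul_apply, hmk _ htΛ, ← ht, inv_mul_cancel_right]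
  · rw [mem_fundDomain, mul_apply, leftMul_apply, hmk _ hδ, ← ht] at hδf
    rw [hδf, mul_inv_cancel_right]

theorem isCompact_fundDomain [Λ.FiniteIndex] : IsCompact (fundDomain Λ) := by
  have hfin : Finite (Quotient (QuotientGroup.rightRel Λ)) :=
    Finite.of_equiv (F d ⧸ Λ) (QuotientGroup.quotientRightRelEquivQuotientLeftRel Λ).symm
  have hT : (Set.range fun q : Quotient (QuotientGroup.rightRel Λ) => q.out.norm).Finite :=
    Set.finite_range _
  obtain ⟨N, hN⟩ := hT.bddAbove
  refine (isCompact_norm_apply_one_le N).of_isClosed_subset ?_ fun f hf => ?_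
  · rw [← isOpen_compl_iff]
    exact isOpen_of_right_invariant (n := 0) fun _ hf _ hk =>
      fun h => hf ((mul_mem_fundDomain_iff (apply_one_of_mem_fixBall hk)).1 h)
  · rw [mem_fundDomain] at hf
    change (f.1 1).norm ≤ N
    rw [← hf]
    exact hN ⟨_, rfl⟩

theorem fundDomain_nonempty : (fundDomain Λ).Nonempty :=
  let ⟨γ, _, h, _⟩ := existsUnique_mem_fundDomain (Λ := Λ) 1
  ⟨leftMul d γ * 1, h⟩

instance : Countable (Λ.map (leftMul d)) :=
  Function.Surjective.countable (f := fun γ : Λ => (⟨leftMul d γ, γ, γ.2, rfl⟩ :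
    Λ.map (leftMul d))) (by
      rintro ⟨_, γ, hγ, rfl⟩
      exact ⟨⟨γ, hγ⟩, rfl⟩)

theorem isFundamentalDomain_preimage_fundDomain (g : Iso d) :
    IsFundamentalDomain (Λ.map (leftMul d)) ((fun f => f * g) ⁻¹' fundDomain Λ)
      (Measure.haar : Measure (Iso d)) := by
  refine IsFundamentalDomain.mk' ((isOpen_fundDomain.preimage
    (continuous_mul_const g)).measurableSet.nullMeasurableSet) fun f => ?_
  obtain ⟨γ, hγ, hf, huniq⟩ := existsUnique_mem_fundDomain (Λ := Λ) (f * g)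
  refine ⟨⟨_, γ, hγ, rfl⟩, ?_, ?_⟩
  · change leftMul d γ * f * g ∈ fundDomain Λ
    rwa [mul_assoc]
  · rintro ⟨_, δ, hδ, rfl⟩ h
    change leftMul d δ * f * g ∈ fundDomain Λ at h
    rw [mul_assoc] at h
    exact Subtype.ext (congrArg (leftMul d) (huniq δ hδ h))

/-! ### The Haar probability measure -/

theorem haar_fundDomain_ne_zero : (Measure.haar : Measure (Iso d)) (fundDomain Λ) ≠ 0 :=
  (isOpen_fundDomain.measure_pos _ fundDomain_nonempty).ne'

theorem haar_fundDomain_ne_top [Λ.FiniteIndex] :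
    (Measure.haar : Measure (Iso d)) (fundDomain Λ) ≠ ⊤ :=
  isCompact_fundDomain.measure_lt_top.ne

theorem haarProb_apply {A : Set (IsoQuotient Λ)} (hA : MeasurableSet A) :
    haarProb Λ A = (Measure.haar (fundDomain Λ))⁻¹ *
      (Measure.haar : Measure (Iso d)) (proj Λ ⁻¹' A ∩ fundDomain Λ) := by
  rw [haarProb, Measure.map_apply measurable_proj hA, Measure.smul_apply,
    Measure.restrict_apply (measurableSet_iff_preimage.1 hA), smul_eq_mul]

instance isProbabilityMeasure_haarProb [Λ.FiniteIndex] : IsProbabilityMeasure (haarProb Λ) := by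
  refine ⟨?_⟩
  rw [haarProb_apply MeasurableSet.univ, Set.preimage_univ, Set.univ_inter]
  exact ENNReal.inv_mul_cancel haar_fundDomain_ne_zero haar_fundDomain_ne_top

/-- A right translate of Haar measure is a multiple of it, and the multiple is `1` because the
lattice `Λ` has a fundamental domain of positive finite measure whose right translates are again
fundamental domains. -/
theorem haar_inter_preimage_mul_right [Λ.FiniteIndex] (g : Iso d) {A : Set (IsoQuotient Λ)}
    (hA : MeasurableSet A) :
    (Measure.haar : Measure (Iso d)) ((fun f => f * g) ⁻¹' (proj Λ ⁻¹' A) ∩ fundDomain Λ) =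
      (Measure.haar : Measure (Iso d)) (proj Λ ⁻¹' A ∩ fundDomain Λ) := by
  let m : Measure (Iso d) := Measure.haar
  let ν : Measure (Iso d) := m.map (fun f => f * g)
  have hcomp : IsFiniteMeasureOnCompacts ν :=
    Measure.IsFiniteMeasureOnCompacts.map m (Homeomorph.mulRight g)
  have hν : ν = Measure.haarScalarFactor ν m • m := Measure.isMulLeftInvariant_eq_smul ν m
  have hD := isFundamentalDomain_preimage_fundDomain (Λ := Λ) (1 : Iso d)
  simp only [mul_one, Set.preimage_id'] at hD
  have key : ∀ B : Set (IsoQuotient Λ), MeasurableSet B →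
      m ((fun f => f * g) ⁻¹' (proj Λ ⁻¹' B) ∩ fundDomain Λ) =
        Measure.haarScalarFactor ν m • m (proj Λ ⁻¹' B ∩ fundDomain Λ) := by
    intro B hB
    have hB' := measurableSet_iff_preimage.1 hB
    have hD' := isFundamentalDomain_preimage_fundDomain (Λ := Λ) g⁻¹
    have e1 : m (proj Λ ⁻¹' B ∩ fundDomain Λ) =
        m (proj Λ ⁻¹' B ∩ (fun f => f * g⁻¹) ⁻¹' fundDomain Λ) := by
      refine hD.measure_set_eq hD' hB' ?_
      rintro ⟨_, γ, hγ, rfl⟩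
      ext f
      have : proj Λ (leftMul d γ * f) = proj Λ f := proj_eq_proj.2 ⟨γ, hγ, rfl⟩
      change proj Λ (leftMul d γ * f) ∈ B ↔ proj Λ f ∈ B
      rw [this]
    have e2 : ν (proj Λ ⁻¹' B ∩ (fun f => f * g⁻¹) ⁻¹' fundDomain Λ) =
        m ((fun f => f * g) ⁻¹' (proj Λ ⁻¹' B) ∩ fundDomain Λ) := by
      rw [Measure.map_apply (measurable_mul_const g)
        (hB'.inter (measurable_mul_const g⁻¹ isOpen_fundDomain.measurableSet)), Set.preimage_inter]
      congr 2
      ext f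
      simp
    rw [← e2, e1]
    exact congrArg (fun μ' : Measure (Iso d) => μ' _) hν
  have h1 := key Set.univ MeasurableSet.univ
  simp only [Set.preimage_univ, Set.univ_inter] at h1
  have hc : Measure.haarScalarFactor ν m = 1 := by
    have h2 : ((Measure.haarScalarFactor ν m : NNReal) : ENNReal) * m (fundDomain Λ) =
        1 * m (fundDomain Λ) := by
      rw [one_mul]
      exact h1.symm
    exact_mod_cast (ENNReal.mul_left_inj haar_fundDomain_ne_zero haar_fundDomain_ne_top).1 h2
  have := key A hA
  rwa [hc, one_smul] at this

theorem measurePreserving_smul [Λ.FiniteIndex] (g : Iso d) :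
    MeasurePreserving (fun x : IsoQuotient Λ => g • x) (haarProb Λ) (haarProb Λ) := by
  refine ⟨measurable_smul_quotient g, ?_⟩
  ext A hA
  rw [Measure.map_apply (measurable_smul_quotient g) hA,
    haarProb_apply (measurable_smul_quotient g hA), haarProb_apply hA]
  congr 1
  exact haar_inter_preimage_mul_right g⁻¹ hA

/-! ### Smooth sets -/

/-- A subset of the quotient is smooth of level `n` if it is invariant under the pointwise
stabilizer of the ball of radius `n`: whether `[f]` belongs to it depends only on the restriction of
`f` to that ball, modulo `Λ`. -/
def IsSmooth (n : ℕ) (A : Set (IsoQuotient Λ)) : Prop :=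
  ∀ k ∈ fixBall (1 : F d) n, ∀ x, k • x ∈ A ↔ x ∈ A

theorem IsSmooth.mono {m n : ℕ} {A : Set (IsoQuotient Λ)} (hA : IsSmooth m A) (h : m ≤ n) :
    IsSmooth n A := fun k hk => hA k (fixBall_anti h hk)

theorem isOpen_preimage_of_isSmooth {n : ℕ} {A : Set (IsoQuotient Λ)} (hA : IsSmooth n A) :
    IsOpen (proj Λ ⁻¹' A) := by
  refine isOpen_of_right_invariant (n := n) fun f hf k hk => ?_
  have := (hA k⁻¹ (inv_mem hk) (proj Λ f)).2 hf
  rwa [smul_proj, inv_inv] at this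

theorem IsSmooth.measurableSet {n : ℕ} {A : Set (IsoQuotient Λ)} (hA : IsSmooth n A) :
    MeasurableSet A :=
  (isOpen_preimage_of_isSmooth hA).measurableSet

theorem IsSmooth.compl {n : ℕ} {A : Set (IsoQuotient Λ)} (hA : IsSmooth n A) : IsSmooth n Aᶜ :=
  fun k hk x => not_congr (hA k hk x)

theorem IsSmooth.union {n : ℕ} {A B : Set (IsoQuotient Λ)} (hA : IsSmooth n A)
    (hB : IsSmooth n B) : IsSmooth n (A ∪ B) :=
  fun k hk x => or_congr (hA k hk x) (hB k hk x)

theorem haarProb_pos_of_isSmooth [Λ.FiniteIndex] {n : ℕ} {A : Set (IsoQuotient Λ)}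
    (hA : IsSmooth n A) (hne : A.Nonempty) : 0 < haarProb Λ A := by
  rw [haarProb_apply hA.measurableSet]
  refine ENNReal.mul_pos (ENNReal.inv_ne_zero.2 haar_fundDomain_ne_top) ?_
  obtain ⟨x, hx⟩ := hne
  obtain ⟨f, rfl⟩ := proj_surjective x
  obtain ⟨γ, hγ, hf, -⟩ := existsUnique_mem_fundDomain (Λ := Λ) f
  refine (((isOpen_preimage_of_isSmooth hA).inter isOpen_fundDomain).measure_pos _
    ⟨leftMul d γ * f, ?_, hf⟩).ne'
  have : proj Λ (leftMul d γ * f) = proj Λ f := proj_eq_proj.2 ⟨γ, hγ, rfl⟩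
  rwa [Set.mem_preimage, this]

theorem isSetAlgebra_isSmooth :
    IsSetAlgebra {A : Set (IsoQuotient Λ) | ∃ n, IsSmooth n A} where
  empty_mem := ⟨0, fun _ _ _ => Iff.rfl⟩
  compl_mem := fun _ ⟨n, hA⟩ => ⟨n, hA.compl⟩
  union_mem := fun _ _ ⟨m, hA⟩ ⟨n, hB⟩ =>
    ⟨max m n, (hA.mono (le_max_left _ _)).union (hB.mono (le_max_right _ _))⟩

/-- The smooth sets generate the quotient Borel structure: the section of `proj Λ` with values in
the fundamental domain commutes with the stabilizer of the root, so it is measurable for the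
σ-algebra that they generate. -/
theorem measurableSpace_eq_generateFrom :
    (inferInstance : MeasurableSpace (IsoQuotient Λ)) =
      MeasurableSpace.generateFrom {A : Set (IsoQuotient Λ) | ∃ n, IsSmooth n A} := by
  refine le_antisymm ?_ (MeasurableSpace.generateFrom_le fun A ⟨n, hA⟩ => hA.measurableSet)
  intro A hA
  have hex : ∀ x : IsoQuotient Λ, ∃ f, proj Λ f = x ∧ f ∈ fundDomain Λ := by
    intro x
    obtain ⟨f, rfl⟩ := proj_surjective x
    obtain ⟨γ, hγ, hf, -⟩ := existsUnique_mem_fundDomain (Λ := Λ) f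
    exact ⟨_, proj_eq_proj.2 ⟨γ, hγ, rfl⟩, hf⟩
  choose σ hσ hσD using hex
  have hσ_unique : ∀ f ∈ fundDomain Λ, σ (proj Λ f) = f := by
    intro f hf
    obtain ⟨γ, hγ, h⟩ := proj_eq_proj.1 (hσ (proj Λ f))
    obtain ⟨γ', -, -, hu⟩ := existsUnique_mem_fundDomain (Λ := Λ) f
    have h1 : γ = γ' := hu γ hγ (by rw [h]; exact hσD _)
    have h2 : 1 = γ' := hu 1 Λ.one_mem (by rwa [map_one, one_mul])
    rw [← h, h1, ← h2, map_one, one_mul]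
  have hσ_smul : ∀ k : Iso d, k.1 1 = 1 → ∀ x, σ (k • x) = σ x * k⁻¹ := by
    intro k hk x
    have hk' : (k⁻¹).1 1 = 1 := by
      change k.1.symm 1 = 1
      rw [Equiv.symm_apply_eq, hk]
    rw [← hσ_unique (σ x * k⁻¹) ((mul_mem_fundDomain_iff hk').2 (hσD x)), ← smul_proj, hσ]
  have hmeas : @Measurable _ _ (MeasurableSpace.generateFrom
      {A : Set (IsoQuotient Λ) | ∃ n, IsSmooth n A}) _ σ := by
    refine @measurable_of_isOpen _ _ _ _ _ (_) _ fun S hS => ?_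
    -- an open set is the union over `n` of its parts that are invariant at level `n`
    have hunion : σ ⁻¹' S = ⋃ n : ℕ, {x | ∀ k ∈ fixBall 1 n, σ x * k ∈ S} := by
      ext x
      simp only [Set.mem_preimage, Set.mem_iUnion, Set.mem_ofPred_eq]
      exact ⟨exists_fixBall_of_isOpen hS, fun ⟨n, h⟩ => by simpa using h 1 (one_mem _)⟩
    rw [hunion]
    refine @MeasurableSet.iUnion _ _ (_) _ _ fun n =>
      MeasurableSpace.measurableSet_generateFrom ⟨n, fun k hk x => ?_⟩
    simp only [Set.mem_ofPred_eq, hσ_smul k (apply_one_of_mem_fixBall hk)]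
    constructor
    · intro h l hl
      have := h (k * l) (mul_mem hk hl)
      rwa [mul_assoc, inv_mul_cancel_left] at this
    · intro h l hl
      rw [mul_assoc]
      exact h _ (mul_mem (inv_mem hk) hl)
  have : A = σ ⁻¹' (proj Λ ⁻¹' A) := by
    ext x
    rw [Set.mem_preimage, Set.mem_preimage, hσ]
  rw [this]
  exact hmeas (measurableSet_iff_preimage.1 hA)

theorem exists_isSmooth_symmDiff_lt [Λ.FiniteIndex] {A : Set (IsoQuotient Λ)}
    (hA : MeasurableSet A) {ε : ℝ} (hε : 0 < ε) :
    ∃ n, ∃ B, IsSmooth n B ∧ (haarProb Λ).real (symmDiff A B) < ε := by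
  obtain ⟨B, ⟨n, hB⟩, h⟩ := (Measure.MeasureDense.of_generateFrom_isSetAlgebra_finite (haarProb Λ)
    isSetAlgebra_isSmooth measurableSpace_eq_generateFrom).approx A hA (measure_ne_top _ _) ε hε
  refine ⟨n, B, hB, ?_⟩
  rw [Measure.real, ← ENNReal.toReal_ofReal hε.le]
  exact (ENNReal.toReal_lt_toReal (measure_ne_top _ _) ENNReal.ofReal_ne_top).2 h

/-! ### Decay of matrix coefficients from a contraction at one scale -/

/-- Let the `ρ γ` be linear isometries and `V` a finite-dimensional subspace with orthogonal
projection `P`. If `γ ↦ P ∘ ρ γ` is multiplicative on `V` along products without cancellation, and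
no nonzero vector of `V` is kept in `V` by some `ρ γ` with `|γ| = L`, then the operators `P ∘ ρ γ`
with `|γ| = L` have norm at most some `c < 1`, so those with `|γ| ≥ k L` have norm at most `c ^ k`.
The vector `a` in the hypothesis of multiplicativity is `P (ρ δ v)`. -/
theorem exists_inner_le_of_contraction {E : Type*} [NormedAddCommGroup E] [InnerProductSpace ℝ E]
    (V : Submodule ℝ E) [FiniteDimensional ℝ V] (ρ : F d → E →ₗᵢ[ℝ] E)
    (hmul : ∀ γ δ : F d, (γ * δ).norm = γ.norm + δ.norm → ∀ v ∈ V, ∃ a ∈ V,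
      (∀ u ∈ V, inner ℝ (ρ δ v) u = inner ℝ a u) ∧
      ∀ u ∈ V, inner ℝ (ρ (γ * δ) v) u = inner ℝ (ρ γ a) u)
    {L : ℕ} (hL : ∀ γ : F d, γ.norm = L → ∀ v ∈ V, ρ γ v ∈ V → v = 0) {ε : ℝ} (hε : 0 < ε) :
    ∃ R : ℕ, ∀ γ : F d, R ≤ γ.norm → ∀ v ∈ V, ∀ w ∈ V,
      |inner ℝ (ρ γ v) w| ≤ ε * (‖v‖ * ‖w‖) := by
  let T : F d → V →L[ℝ] V := fun γ =>
    V.orthogonalProjectionOnto.comp ((ρ γ).toContinuousLinearMap.comp V.subtypeL)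
  have hT : ∀ γ (v u : V), inner ℝ (T γ v : E) (u : E) = inner ℝ (ρ γ v) (u : E) := fun γ v u =>
    V.inner_orthogonalProjectionOnto_eq_of_mem_right u (ρ γ v)
  have hT_le : ∀ γ (v : V), ‖T γ v‖ ≤ ‖v‖ := fun γ v =>
    (V.norm_orthogonalProjectionOnto_apply_le (ρ γ v)).trans_eq ((ρ γ).norm_map v)
  have hT_lt : ∀ γ : F d, γ.norm = L → ∀ v : V, v ≠ 0 → ‖T γ v‖ < ‖v‖ := by
    intro γ hγ v hv
    refine lt_of_le_of_ne (hT_le γ v) fun h => hv ?_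
    have hmem : ρ γ v ∈ V := by
      rw [V.mem_iff_norm_starProjection]
      exact h.trans ((ρ γ).norm_map v).symm
    exact Subtype.ext (hL γ hγ v v.2 hmem)
  have hcontr : ∀ γ : F d, γ.norm = L → ∃ c : ℝ, 0 ≤ c ∧ c < 1 ∧ ∀ v : V, ‖T γ v‖ ≤ c * ‖v‖ := by
    intro γ hγ
    rcases (Metric.sphere (0 : V) 1).eq_empty_or_nonempty with h | h
    · have : ∀ v : V, v = 0 := by
        intro v
        by_contra hv
        have hm : (‖v‖⁻¹ • v) ∈ Metric.sphere (0 : V) 1 := by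
          simp [norm_smul, hv]
        rw [h] at hm
        exact hm
      exact ⟨0, le_rfl, one_pos, fun v => by simp [this v]⟩
    · obtain ⟨v₀, hv₀, hmax⟩ := (isCompact_sphere (0 : V) 1).exists_isMaxOn h
        (T γ).continuous.norm.continuousOn
      have hv₀' : ‖v₀‖ = 1 := by simpa using hv₀
      refine ⟨‖T γ v₀‖, norm_nonneg _, ?_, fun v => ?_⟩
      · exact (hT_lt γ hγ v₀ (by rintro rfl; simp at hv₀')).trans_eq hv₀'
      · by_cases hv : v = 0
        · simp [hv]
        have hvn : 0 < ‖v‖ := norm_pos_iff.2 hv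
        have hle : ‖T γ (‖v‖⁻¹ • v)‖ ≤ ‖T γ v₀‖ :=
          hmax (show (‖v‖⁻¹ • v) ∈ Metric.sphere (0 : V) 1 by simp [norm_smul, hv])
        rwa [map_smul, norm_smul, norm_inv, norm_norm, inv_mul_le_iff₀ hvn, mul_comm] at hle
  obtain ⟨c, hc0, hc1, hc⟩ : ∃ c : ℝ, 0 ≤ c ∧ c < 1 ∧
      ∀ γ : F d, γ.norm = L → ∀ v : V, ‖T γ v‖ ≤ c * ‖v‖ := by
    have hfin : {γ : F d | γ.norm = L}.Finite :=
      (finite_norm_le d L).subset fun γ (hγ : γ.norm = L) => hγ.le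
    rcases Set.eq_empty_or_nonempty {γ : F d | γ.norm = L} with h | h
    · refine ⟨0, le_rfl, one_pos, fun γ hγ => ?_⟩
      have hm : γ ∈ {γ : F d | γ.norm = L} := hγ
      rw [h] at hm
      exact hm.elim
    choose! c hc0 hc1 hc using hcontr
    obtain ⟨γ₀, hγ₀, hmax⟩ := Set.exists_max_image _ c hfin h
    exact ⟨c γ₀, hc0 γ₀ hγ₀, hc1 γ₀ hγ₀, fun γ hγ v => (hc γ hγ v).trans
      (mul_le_mul_of_nonneg_right (hmax γ hγ) (norm_nonneg v))⟩
  have hTmul : ∀ γ δ : F d, (γ * δ).norm = γ.norm + δ.norm → ∀ v : V,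
      T (γ * δ) v = T γ (T δ v) := by
    intro γ δ h v
    obtain ⟨a, ha, ha1, ha2⟩ := hmul γ δ h v v.2
    have e1 : T δ v = ⟨a, ha⟩ := by
      refine ext_inner_right ℝ fun u => ?_
      exact (hT δ v u).trans (ha1 u u.2)
    refine ext_inner_right ℝ fun u => ?_
    rw [e1]
    exact (hT (γ * δ) v u).trans ((ha2 u u.2).trans (hT γ ⟨a, ha⟩ u).symm)
  have hpow : ∀ (k : ℕ) (γ : F d), k * L ≤ γ.norm → ∀ v : V, ‖T γ v‖ ≤ c ^ k * ‖v‖ := by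
    intro k
    induction k with
    | zero => simpa using fun γ => hT_le γ
    | succ k ih =>
      intro γ hγ v
      rw [Nat.succ_mul] at hγ
      obtain ⟨α, β, rfl, hα, hn⟩ := exists_mul_of_le_norm (γ := γ) (m := L) (by omega)
      rw [hTmul α β hn, pow_succ', mul_assoc]
      exact (hc α hα _).trans (mul_le_mul_of_nonneg_left (ih β (by omega) v) hc0)
  obtain ⟨k, hk⟩ := exists_pow_lt_of_lt_one hε hc1
  refine ⟨k * L, fun γ hγ v hv w hw => ?_⟩
  rw [← hT γ ⟨v, hv⟩ ⟨w, hw⟩, ← mul_assoc]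
  refine (abs_real_inner_le_norm _ _).trans (mul_le_mul_of_nonneg_right ?_ (norm_nonneg w))
  exact (hpow k γ hγ ⟨v, hv⟩).trans (mul_le_mul_of_nonneg_right hk.le (norm_nonneg _))

/-! ### Smooth functions of mean zero -/

/-- A function on the quotient that is invariant under the pointwise stabilizer of the ball of
radius `n` around the root. -/
def IsSmoothFn (n : ℕ) (φ : IsoQuotient Λ → ℝ) : Prop :=
  ∀ k ∈ fixBall (1 : F d) n, ∀ x, φ (k • x) = φ x

theorem IsSmoothFn.mono {m n : ℕ} {φ : IsoQuotient Λ → ℝ} (hφ : IsSmoothFn m φ) (h : m ≤ n) :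
    IsSmoothFn n φ := fun k hk => hφ k (fixBall_anti h hk)

theorem IsSmoothFn.isSmooth_preimage {n : ℕ} {φ : IsoQuotient Λ → ℝ} (hφ : IsSmoothFn n φ)
    (s : Set ℝ) : IsSmooth n (φ ⁻¹' s) := fun k hk x => by
  rw [Set.mem_preimage, hφ k hk, Set.mem_preimage]

theorem IsSmoothFn.measurable {n : ℕ} {φ : IsoQuotient Λ → ℝ} (hφ : IsSmoothFn n φ) :
    Measurable φ := fun s _ => (hφ.isSmooth_preimage s).measurableSet

/-- The quotient is compact, so the pointwise stabilizer of a ball has finitely many orbits. -/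
theorem exists_finite_orbit_reps [Λ.FiniteIndex] (n : ℕ) : ∃ R : Finset (IsoQuotient Λ),
    ∀ x, ∃ r ∈ R, ∃ k ∈ fixBall (1 : F d) n, k • r = x := by
  classical
  obtain ⟨R, hR⟩ := exists_finite_cover (isCompact_fundDomain (Λ := Λ)) n
  refine ⟨R.image (proj Λ), fun x => ?_⟩
  obtain ⟨f, rfl⟩ := proj_surjective x
  obtain ⟨γ, hγ, hf, -⟩ := existsUnique_mem_fundDomain (Λ := Λ) f
  obtain ⟨r, hr, hk⟩ := hR _ hf
  refine ⟨proj Λ r, Finset.mem_image_of_mem _ hr, _, inv_mem hk, ?_⟩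
  rw [smul_proj, inv_inv, mul_inv_cancel_left]
  exact proj_eq_proj.2 ⟨γ, hγ, rfl⟩

theorem IsSmoothFn.exists_bound [Λ.FiniteIndex] {n : ℕ} {φ : IsoQuotient Λ → ℝ}
    (hφ : IsSmoothFn n φ) : ∃ C, ∀ x, ‖φ x‖ ≤ C := by
  obtain ⟨R, hR⟩ := exists_finite_orbit_reps (Λ := Λ) n
  refine ⟨∑ r ∈ R, ‖φ r‖, fun x => ?_⟩
  obtain ⟨r, hr, k, hk, rfl⟩ := hR x
  rw [hφ k hk]
  exact Finset.single_le_sum (f := fun r => ‖φ r‖) (fun _ _ => norm_nonneg _) hr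

theorem IsSmoothFn.integrable [Λ.FiniteIndex] {n : ℕ} {φ : IsoQuotient Λ → ℝ}
    (hφ : IsSmoothFn n φ) : Integrable φ (haarProb Λ) := by
  obtain ⟨C, hC⟩ := hφ.exists_bound
  exact Integrable.of_bound hφ.measurable.aestronglyMeasurable C (ae_of_all _ hC)

theorem IsSmoothFn.mul {n : ℕ} {φ ψ : IsoQuotient Λ → ℝ} (hφ : IsSmoothFn n φ)
    (hψ : IsSmoothFn n ψ) : IsSmoothFn n fun x => φ x * ψ x :=
  fun k hk x => by simp only [hφ k hk, hψ k hk]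

/-- If `Λ` contains odd elements, the even isometries act transitively on the quotient. -/
theorem exists_even_smul_eq (hΛ : ¬ Λ ≤ evenSubgroup d) (x y : IsoQuotient Λ) :
    ∃ g : Iso d, Even (g.1 1).norm ∧ g • x = y := by
  obtain ⟨f, rfl⟩ := proj_surjective x
  obtain ⟨h, rfl⟩ := proj_surjective y
  obtain ⟨γ, hγ, hodd⟩ := SetLike.not_le_iff_exists.1 hΛ
  have key : ∀ δ ∈ Λ, (h⁻¹ * (leftMul d δ * f)) • proj Λ f = proj Λ h := by
    intro δ hδ
    rw [smul_proj]
    refine proj_eq_proj.2 ⟨δ⁻¹, Λ.inv_mem hδ, ?_⟩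
    rw [map_inv]
    group
  by_cases he : Even ((h⁻¹ * f).1 1).norm
  · refine ⟨_, ?_, key 1 Λ.one_mem⟩
    rwa [(leftMul d).map_one, one_mul]
  · refine ⟨_, ?_, key γ hγ⟩
    have hodd' : ¬ Even γ.norm := hodd
    rw [mul_apply, even_norm_apply] at he
    rw [mul_apply, mul_apply, leftMul_apply, even_norm_apply, even_norm_mul]
    tauto

variable (Λ) in
/-- The space of smooth functions of mean zero on the quotient. -/
def smoothSubmodule [Λ.FiniteIndex] : Submodule ℝ (IsoQuotient Λ → ℝ) where
  carrier := {φ | (∃ n, IsSmoothFn n φ) ∧ ∫ x, φ x ∂haarProb Λ = 0}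
  add_mem' := by
    rintro φ ψ ⟨⟨m, hφ⟩, hφ0⟩ ⟨⟨n, hψ⟩, hψ0⟩
    refine ⟨⟨max m n, fun k hk x => ?_⟩, ?_⟩
    · rw [Pi.add_apply, Pi.add_apply, hφ.mono (le_max_left m n) k hk,
        hψ.mono (le_max_right m n) k hk]
    · simp only [Pi.add_apply]
      rw [integral_add hφ.integrable hψ.integrable, hφ0, hψ0, add_zero]
  zero_mem' := ⟨⟨0, fun _ _ _ => rfl⟩, by simp⟩
  smul_mem' := by
    rintro c φ ⟨⟨n, hφ⟩, hφ0⟩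
    refine ⟨⟨n, fun k hk x => ?_⟩, ?_⟩
    · rw [Pi.smul_apply, Pi.smul_apply, hφ k hk]
    · simp only [Pi.smul_apply]
      rw [integral_smul, hφ0, smul_zero]

variable (Λ) in
/-- The space of smooth functions of mean zero as a type of its own, which is to carry the `L²` norm
and not the topology of pointwise convergence. -/
def SmoothFn [Λ.FiniteIndex] : Type := smoothSubmodule Λ

namespace SmoothFn

variable [Λ.FiniteIndex]

noncomputable instance : AddCommGroup (SmoothFn Λ) :=
  inferInstanceAs (AddCommGroup (smoothSubmodule Λ))

noncomputable instance : Module ℝ (SmoothFn Λ) :=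
  inferInstanceAs (Module ℝ (smoothSubmodule Λ))

instance : CoeFun (SmoothFn Λ) fun _ => IsoQuotient Λ → ℝ := ⟨fun φ => φ.1⟩

theorem ext {φ ψ : SmoothFn Λ} (h : ∀ x, φ x = ψ x) : φ = ψ := Subtype.ext (funext h)

theorem add_apply (φ ψ : SmoothFn Λ) (x : IsoQuotient Λ) : (φ + ψ) x = φ x + ψ x := rfl

theorem smul_apply (c : ℝ) (φ : SmoothFn Λ) (x : IsoQuotient Λ) : (c • φ) x = c * φ x := rfl

theorem zero_apply (x : IsoQuotient Λ) : (0 : SmoothFn Λ) x = 0 := rfl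

theorem exists_isSmoothFn_pair (φ ψ : SmoothFn Λ) : ∃ n, IsSmoothFn n φ.1 ∧ IsSmoothFn n ψ.1 :=
  let ⟨m, hm⟩ := φ.2.1
  let ⟨n, hn⟩ := ψ.2.1
  ⟨max m n, hm.mono (le_max_left _ _), hn.mono (le_max_right _ _)⟩

theorem integrable_mul (φ ψ : SmoothFn Λ) : Integrable (fun x => φ x * ψ x) (haarProb Λ) :=
  let ⟨_, hφ, hψ⟩ := exists_isSmoothFn_pair φ ψ
  (hφ.mul hψ).integrable

/-- The `L²` inner product. It is definite because a smooth function is constant on sets of positive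
measure around each point. -/
@[reducible]
noncomputable def innerCore : InnerProductSpace.Core ℝ (SmoothFn Λ) where
  inner φ ψ := ∫ x, φ x * ψ x ∂haarProb Λ
  conj_inner_symm φ ψ := by simp [mul_comm]
  re_inner_nonneg φ := integral_nonneg fun x => mul_self_nonneg (φ x)
  add_left φ ψ χ := by
    simp only [add_apply, add_mul]
    exact integral_add (integrable_mul φ χ) (integrable_mul ψ χ)
  smul_left φ ψ c := by
    simp only [smul_apply, mul_assoc]
    exact integral_const_mul c _
  definite φ h := by
    have h0 := (integral_eq_zero_iff_of_nonneg (fun x => mul_self_nonneg (φ x))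
      (integrable_mul φ φ)).1 h
    obtain ⟨n, hφ⟩ := φ.2.1
    refine ext fun x => ?_
    by_contra hx
    have hpos := haarProb_pos_of_isSmooth (hφ.isSmooth_preimage {0}ᶜ) ⟨x, hx⟩
    refine hpos.ne' (measure_mono_null (fun y hy => ?_) h0)
    exact fun hy' => hy (mul_self_eq_zero.1 hy')

noncomputable instance : NormedAddCommGroup (SmoothFn Λ) := innerCore.toNormedAddCommGroup

noncomputable instance : InnerProductSpace ℝ (SmoothFn Λ) :=
  InnerProductSpace.ofCore innerCore.toCore

theorem inner_def (φ ψ : SmoothFn Λ) : inner ℝ φ ψ = ∫ x, φ x * ψ x ∂haarProb Λ := rfl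

theorem integral_mul_comp_smul (g : Iso d) (φ ψ : IsoQuotient Λ → ℝ)
    (hφψ : Measurable fun x => φ x * ψ x) :
    ∫ x, φ (g • x) * ψ (g • x) ∂haarProb Λ = ∫ x, φ x * ψ x ∂haarProb Λ := by
  have h := measurePreserving_smul (Λ := Λ) g
  conv_rhs => rw [← h.map_eq]
  rw [integral_map h.aemeasurable hφψ.aestronglyMeasurable]

/-- The Koopman representation: `g` acts on a function by `φ ↦ φ (g⁻¹ • ·)`. -/
noncomputable def koopman (g : Iso d) : SmoothFn Λ →ₗᵢ[ℝ] SmoothFn Λ where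
  toFun φ := ⟨fun x => φ (g⁻¹ • x), by
    obtain ⟨⟨n, hn⟩, hφ⟩ := φ.2
    refine ⟨⟨(g.1 1).norm + n, fun k hk x => ?_⟩, ?_⟩
    · have hk' : k ∈ fixBall (g.1 1) n := fun γ hγ => mem_fixBall_one.1 hk γ (by
        have := FreeGroup.norm_mul_le (g.1 1) ((g.1 1)⁻¹ * γ)
        rw [mul_inv_cancel_left] at this
        omega)
      have hc := conj_mem_fixBall (h := g⁻¹) hk'
      have h1 : (g⁻¹).1 (g.1 1) = 1 := g.1.symm_apply_apply 1
      rw [h1, inv_inv] at hc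
      have := hn _ hc (g⁻¹ • x)
      rw [← mul_smul, mul_inv_cancel_right, mul_smul] at this
      exact this
    · have h := measurePreserving_smul (Λ := Λ) g⁻¹
      rw [← h.map_eq, integral_map h.aemeasurable hn.measurable.aestronglyMeasurable] at hφ
      exact hφ⟩
  map_add' φ ψ := rfl
  map_smul' c φ := rfl
  norm_map' φ := by
    have h := integral_mul_comp_smul g⁻¹ φ φ (let ⟨_, hφ⟩ := φ.2.1; (hφ.mul hφ).measurable)
    rw [@norm_eq_sqrt_real_inner, @norm_eq_sqrt_real_inner]
    exact congrArg Real.sqrt h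

theorem koopman_apply (g : Iso d) (φ : SmoothFn Λ) (x : IsoQuotient Λ) :
    koopman g φ x = φ (g⁻¹ • x) := rfl

theorem koopman_mul (g h : Iso d) (φ : SmoothFn Λ) :
    koopman (g * h) φ = koopman g (koopman h φ) := by
  refine ext fun x => ?_
  rw [koopman_apply, koopman_apply, koopman_apply, mul_inv_rev, mul_smul]

theorem koopman_one (φ : SmoothFn Λ) : koopman 1 φ = φ := by
  refine ext fun x => ?_
  rw [koopman_apply, inv_one, one_smul]

theorem inner_koopman_left (g : Iso d) (φ ψ : SmoothFn Λ) :
    inner ℝ (koopman g φ) ψ = inner ℝ φ (koopman g⁻¹ ψ) := by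
  rw [← (koopman g).inner_map_map φ, ← koopman_mul, mul_inv_cancel, koopman_one]

/-! ### The vectors of level `n` -/

variable (Λ) in
/-- The subspace of functions that are invariant under the pointwise stabilizer of the ball of
radius `n`. -/
def level (n : ℕ) : Submodule ℝ (SmoothFn Λ) where
  carrier := {φ | IsSmoothFn n φ.1}
  add_mem' := fun {φ ψ} hφ hψ k hk x => by
    rw [add_apply, add_apply, hφ k hk, hψ k hk]
  zero_mem' := fun _ _ _ => rfl
  smul_mem' := fun c φ hφ k hk x => by
    rw [smul_apply, smul_apply, hφ k hk]

theorem mem_level {n : ℕ} {φ : SmoothFn Λ} : φ ∈ level Λ n ↔ IsSmoothFn n φ.1 := Iff.rfl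

theorem mem_level_iff_koopman {n : ℕ} {φ : SmoothFn Λ} :
    φ ∈ level Λ n ↔ ∀ k ∈ fixBall (1 : F d) n, koopman k φ = φ := by
  constructor
  · exact fun h k hk => ext fun x => h k⁻¹ (inv_mem hk) x
  · intro h k hk x
    have := congrArg (fun ψ : SmoothFn Λ => ψ x) (h k⁻¹ (inv_mem hk))
    simpa [koopman_apply] using this

instance (n : ℕ) : FiniteDimensional ℝ (level Λ n) := by
  obtain ⟨R, hR⟩ := exists_finite_orbit_reps (Λ := Λ) n
  let e : level Λ n →ₗ[ℝ] (R → ℝ) :=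
    { toFun := fun φ r => φ.1 r.1
      map_add' := fun _ _ => rfl
      map_smul' := fun _ _ => rfl }
  refine FiniteDimensional.of_injective e fun φ ψ h => Subtype.ext (ext fun x => ?_)
  obtain ⟨r, hr, k, hk, rfl⟩ := hR x
  rw [φ.2 k hk, ψ.2 k hk]
  exact congrFun h ⟨r, hr⟩

/-- The stabilizer of the root normalizes the pointwise stabilizers of balls around it. -/
theorem koopman_mem_level {n : ℕ} {g : Iso d} (hg : g.1 1 = 1) {φ : SmoothFn Λ}
    (hφ : φ ∈ level Λ n) : koopman g φ ∈ level Λ n := by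
  rw [mem_level_iff_koopman] at hφ ⊢
  intro k hk
  have hg' : (g⁻¹).1 1 = 1 := by
    change g.1.symm 1 = 1
    rw [Equiv.symm_apply_eq, hg]
  have hc := conj_mem_fixBall (h := g⁻¹) hk
  rw [hg', inv_inv] at hc
  rw [← koopman_mul, show k * g = g * (g⁻¹ * k * g) by group, koopman_mul, hφ _ hc]

/-- The average of `φ` over its finite orbit under the pointwise stabilizer of a ball has the same
inner products as `φ` with vectors that do not distinguish the points of that orbit. -/
theorem exists_average (n : ℕ) (φ : SmoothFn Λ) : ∃ a ∈ level Λ n, ∀ ψ : SmoothFn Λ,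
    (∀ k ∈ fixBall (1 : F d) n, inner ℝ (koopman k φ) ψ = inner ℝ φ ψ) →
      inner ℝ a ψ = inner ℝ φ ψ := by
  classical
  let O : Set (SmoothFn Λ) := {χ | ∃ k ∈ fixBall (1 : F d) n, koopman k φ = χ}
  have hO : O.Finite := by
    obtain ⟨m, hm⟩ := φ.2.1
    obtain ⟨R, hR⟩ := exists_finite_cover (isCompact_stabilizer d) m
    refine (R.image fun r => koopman r φ).finite_toSet.subset ?_
    rintro _ ⟨k, hk, rfl⟩
    obtain ⟨r, hr, hrk⟩ := hR k (apply_one_of_mem_fixBall hk)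
    refine Finset.mem_coe.2 (Finset.mem_image.2 ⟨r, hr, ?_⟩)
    conv_rhs => rw [← mul_inv_cancel_left r k, koopman_mul]
    rw [mem_level_iff_koopman.1 (mem_level.2 hm) _ hrk]
  have hφO : φ ∈ hO.toFinset := hO.mem_toFinset.2 ⟨1, one_mem _, koopman_one φ⟩
  have hcard : (hO.toFinset.card : ℝ) ≠ 0 :=
    Nat.cast_ne_zero.2 (Finset.card_ne_zero_of_mem hφO)
  refine ⟨(hO.toFinset.card : ℝ)⁻¹ • ∑ χ ∈ hO.toFinset, χ, ?_, fun ψ hψ => ?_⟩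
  · rw [mem_level_iff_koopman]
    intro k hk
    rw [map_smul, map_sum]
    congr 1
    refine Finset.sum_bij' (fun χ _ => koopman k χ) (fun χ _ => koopman k⁻¹ χ) ?_ ?_ ?_ ?_ ?_
    · intro χ hχ
      obtain ⟨l, hl, rfl⟩ := hO.mem_toFinset.1 hχ
      exact hO.mem_toFinset.2 ⟨k * l, mul_mem hk hl, koopman_mul _ _ _⟩
    · intro χ hχ
      obtain ⟨l, hl, rfl⟩ := hO.mem_toFinset.1 hχ
      exact hO.mem_toFinset.2 ⟨k⁻¹ * l, mul_mem (inv_mem hk) hl, koopman_mul _ _ _⟩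
    · intro χ _
      rw [← koopman_mul, inv_mul_cancel, koopman_one]
    · intro χ _
      rw [← koopman_mul, mul_inv_cancel, koopman_one]
    · exact fun _ _ => rfl
  · rw [real_inner_smul_left, sum_inner, Finset.sum_congr rfl (g := fun _ => inner ℝ φ ψ),
      Finset.sum_const, nsmul_eq_mul, inv_mul_cancel_left₀ hcard]
    intro χ hχ
    obtain ⟨k, hk, rfl⟩ := hO.mem_toFinset.1 hχ
    exact hψ k hk

theorem koopman_leftMul_of_mem_fixBall {n : ℕ} {φ : SmoothFn Λ} (hφ : φ ∈ level Λ n) {γ : F d}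
    {k : Iso d} (hk : k ∈ fixBall γ n) :
    koopman k (koopman (leftMul d γ) φ) = koopman (leftMul d γ) φ := by
  have hc := conj_mem_fixBall (h := (leftMul d γ)⁻¹) hk
  rw [leftMul_inv_apply, inv_mul_cancel, inv_inv] at hc
  rw [← koopman_mul, show k * leftMul d γ = leftMul d γ * ((leftMul d γ)⁻¹ * k * leftMul d γ) by
    group, koopman_mul, mem_level_iff_koopman.1 hφ _ hc]

/-- Compressions of translations to the vectors of level `n` are multiplicative along products
without cancellation. -/
theorem exists_projection_mul {n : ℕ} (hn : 1 ≤ n) {γ δ : F d}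
    (h : (γ * δ).norm = γ.norm + δ.norm) {φ : SmoothFn Λ} (hφ : φ ∈ level Λ n) :
    ∃ a ∈ level Λ n,
      (∀ ψ ∈ level Λ n, inner ℝ (koopman (leftMul d δ) φ) ψ = inner ℝ a ψ) ∧
      ∀ ψ ∈ level Λ n, inner ℝ (koopman (leftMul d (γ * δ)) φ) ψ =
        inner ℝ (koopman (leftMul d γ) a) ψ := by
  obtain ⟨a, ha, hav⟩ := exists_average n (koopman (leftMul d δ) φ)
  refine ⟨a, ha, fun ψ hψ => (hav ψ fun k hk => ?_).symm, fun ψ hψ => ?_⟩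
  · rw [inner_koopman_left, mem_level_iff_koopman.1 hψ _ (inv_mem hk)]
  · rw [inner_koopman_left (leftMul d γ), hav, map_mul, koopman_mul, inner_koopman_left]
    intro k hk
    obtain ⟨k₁, hk₁, k₂, hk₂, rfl⟩ := exists_split_fixBall hn h hk
    rw [koopman_mul, koopman_leftMul_of_mem_fixBall hφ hk₂, inner_koopman_left, ← map_inv,
      koopman_leftMul_of_mem_fixBall hψ (inv_mem hk₁)]

/-- A function of level `n` that stays of level `n` under a long translation is invariant under two
distant ball stabilizers, hence under all even isometries, hence constant. -/
theorem eq_zero_of_koopman_mem_level (hd : 2 ≤ d) (hΛ : ¬ Λ ≤ evenSubgroup d) {n : ℕ} {γ : F d}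
    (hγ : γ.norm = 2 * n + 3) {φ : SmoothFn Λ} (hφ : φ ∈ level Λ n)
    (hφ' : koopman (leftMul d γ) φ ∈ level Λ n) : φ = 0 := by
  let S : Subgroup (Iso d) :=
    { carrier := {g | koopman g φ = φ}
      mul_mem' := fun {g h} hg hh => by
        change koopman (g * h) φ = φ
        rw [koopman_mul, hh, hg]
      one_mem' := koopman_one φ
      inv_mem' := fun {g} hg => by
        change koopman g⁻¹ φ = φ
        conv_lhs => rw [← show koopman g φ = φ from hg]
        rw [← koopman_mul, inv_mul_cancel, koopman_one] }
  have h₁ : fixBall 1 n ≤ S := fun k hk => mem_level_iff_koopman.1 hφ k hk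
  have h₂ : fixBall γ⁻¹ n ≤ S := fun k hk => by
    have := koopman_leftMul_of_mem_fixBall hφ' hk
    rw [map_inv, ← koopman_mul (leftMul d γ)⁻¹, inv_mul_cancel, koopman_one] at this
    exact this
  have hconst : ∀ x, φ x = φ (proj Λ 1) := by
    intro x
    obtain ⟨g, hg, hgx⟩ := exists_even_smul_eq hΛ (proj Λ 1) x
    have hgS : koopman g φ = φ :=
      even_le_of_fixBall hd S (by rwa [FreeGroup.norm_inv_eq]) h₁ h₂ hg
    have h := koopman_apply g φ (g • proj Λ 1)
    rwa [hgS, inv_smul_smul, hgx] at h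
  have hint := φ.2.2
  simp only [hconst, integral_const, probReal_univ, one_smul] at hint
  exact ext fun x => by rw [hconst, hint, zero_apply]

/-- The Howe–Moore property for smooth vectors: if `Λ` contains odd elements, the matrix
coefficients of smooth functions of mean zero vanish at infinity on `Iso(F_d)`. -/
theorem exists_inner_koopman_le (hd : 2 ≤ d) (hΛ : ¬ Λ ≤ evenSubgroup d) (φ ψ : SmoothFn Λ) {ε : ℝ}
    (hε : 0 < ε) :
    ∃ R : ℕ, ∀ g : Iso d, R ≤ (g.1 1).norm → |inner ℝ (koopman g φ) ψ| < ε := by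
  obtain ⟨m, hφm, hψm⟩ := exists_isSmoothFn_pair φ ψ
  have hφ : φ ∈ level Λ (m + 1) := mem_level.2 (hφm.mono m.le_succ)
  have hψ : ψ ∈ level Λ (m + 1) := mem_level.2 (hψm.mono m.le_succ)
  have hpos : 0 < ‖φ‖ * ‖ψ‖ + 1 := by positivity
  obtain ⟨R, hR⟩ := exists_inner_le_of_contraction (level Λ (m + 1))
    (fun γ => koopman (leftMul d γ))
    (fun γ δ h v hv => exists_projection_mul (Nat.succ_pos m) h hv)
    (fun γ hγ v hv hv' => eq_zero_of_koopman_mem_level hd hΛ hγ hv hv')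
    (div_pos hε hpos)
  refine ⟨R, fun g hg => ?_⟩
  have hk : ((leftMul d (g.1 1))⁻¹ * g).1 1 = 1 := by
    rw [mul_apply, leftMul_inv_apply, inv_mul_cancel]
  have h := hR (g.1 1) hg _ (koopman_mem_level hk hφ) ψ hψ
  rw [← koopman_mul, mul_inv_cancel_left, LinearIsometry.norm_map] at h
  refine h.trans_lt ?_
  rw [div_mul_eq_mul_div, div_lt_iff₀ hpos]
  exact mul_lt_mul_of_pos_left (lt_add_one _) hε

end SmoothFn

/-! ### Mixing -/

theorem image_smul_eq_preimage {G X : Type*} [Group G] [MulAction G X] (g : G) (A : Set X) :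
    (fun x => g • x) '' A = (fun x => g⁻¹ • x) ⁻¹' A :=
  congrFun (Set.image_eq_preimage_of_inverse (inv_smul_smul g) (smul_inv_smul g)) A

theorem measurableSet_image_smul (g : Iso d) {A : Set (IsoQuotient Λ)} (hA : MeasurableSet A) :
    MeasurableSet ((fun x => g • x) '' A) := by
  rw [image_smul_eq_preimage]
  exact measurable_smul_quotient g⁻¹ hA

theorem measureReal_image_smul [Λ.FiniteIndex] (g : Iso d) {A : Set (IsoQuotient Λ)}
    (hA : MeasurableSet A) :
    (haarProb Λ).real ((fun x => g • x) '' A) = (haarProb Λ).real A := by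
  rw [image_smul_eq_preimage, Measure.real, (measurePreserving_smul g⁻¹).measure_preimage
    hA.nullMeasurableSet, Measure.real]

/-- The defect of independence of `g A` and `B`. -/
noncomputable def correlation (A B : Set (IsoQuotient Λ)) (g : Iso d) : ℝ :=
  (haarProb Λ).real (((fun x => g • x) '' A) ∩ B) - (haarProb Λ).real A * (haarProb Λ).real B

theorem correlation_mul_of_isSmooth {n : ℕ} {A : Set (IsoQuotient Λ)} (hA : IsSmooth n A)
    (B : Set (IsoQuotient Λ)) (g : Iso d) {k : Iso d} (hk : k ∈ fixBall (1 : F d) n) :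
    correlation A B (g * k) = correlation A B g := by
  have : (fun x : IsoQuotient Λ => (g * k) • x) '' A = (fun x => g • x) '' A := by
    rw [image_smul_eq_preimage, image_smul_eq_preimage]
    ext x
    rw [Set.mem_preimage, Set.mem_preimage, mul_inv_rev, mul_smul, hA _ (inv_mem hk)]
  rw [correlation, this, correlation]

/-- The correlation depends on the sets continuously in measure, uniformly in the isometry. -/
theorem abs_correlation_sub_le [Λ.FiniteIndex] {A A' B B' : Set (IsoQuotient Λ)}
    (hA : MeasurableSet A) (hA' : MeasurableSet A') (hB : MeasurableSet B) (hB' : MeasurableSet B')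
    (g : Iso d) : |correlation A B g - correlation A' B' g| ≤
      2 * ((haarProb Λ).real (symmDiff A A') + (haarProb Λ).real (symmDiff B B')) := by
  set μ := haarProb Λ
  set T : Set (IsoQuotient Λ) → Set (IsoQuotient Λ) := fun C => (fun x => g • x) '' C
  have h1 : |μ.real (T A ∩ B) - μ.real (T A' ∩ B')| ≤
      μ.real (symmDiff A A') + μ.real (symmDiff B B') := by
    refine (abs_measureReal_sub_le_measureReal_symmDiff
      (((measurableSet_image_smul g hA).inter hB).nullMeasurableSet)
      (((measurableSet_image_smul g hA').inter hB').nullMeasurableSet)).trans ?_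
    rw [← measureReal_image_smul g (hA.symmDiff hA')]
    refine (measureReal_mono ?_).trans (measureReal_union_le _ _)
    rw [image_smul_eq_preimage]
    simp only [image_smul_eq_preimage]
    intro x
    simp only [Set.mem_symmDiff, Set.mem_inter_iff, Set.mem_union, Set.mem_preimage]
    tauto
  have hAA := abs_measureReal_sub_le_measureReal_symmDiff (μ := μ) hA.nullMeasurableSet
    hA'.nullMeasurableSet
  have hBB := abs_measureReal_sub_le_measureReal_symmDiff (μ := μ) hB.nullMeasurableSet
    hB'.nullMeasurableSet
  have h2 : |μ.real A * μ.real B - μ.real A' * μ.real B'| ≤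
      μ.real (symmDiff A A') + μ.real (symmDiff B B') := by
    have e : μ.real A * μ.real B - μ.real A' * μ.real B' =
        (μ.real A - μ.real A') * μ.real B + μ.real A' * (μ.real B - μ.real B') := by ring
    rw [e]
    refine (abs_add_le _ _).trans (add_le_add ?_ ?_)
    · rw [abs_mul, abs_of_nonneg (measureReal_nonneg (μ := μ) (s := B))]
      exact (mul_le_of_le_one_right (abs_nonneg _) measureReal_le_one).trans hAA
    · rw [abs_mul, abs_of_nonneg (measureReal_nonneg (μ := μ) (s := A'))]
      exact (mul_le_of_le_one_left (abs_nonneg _) measureReal_le_one).trans hBB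
  have e : correlation A B g - correlation A' B' g =
      (μ.real (T A ∩ B) - μ.real (T A' ∩ B')) - (μ.real A * μ.real B - μ.real A' * μ.real B') := by
    simp only [correlation, T, μ]
    ring
  rw [e]
  refine (abs_sub _ _).trans ?_
  linarith

theorem exists_isSmooth_correlation_lt [Λ.FiniteIndex] {A B : Set (IsoQuotient Λ)}
    (hA : MeasurableSet A) (hB : MeasurableSet B) {ε : ℝ} (hε : 0 < ε) :
    ∃ n, ∃ A' B' : Set (IsoQuotient Λ), IsSmooth n A' ∧ IsSmooth n B' ∧
      ∀ g, |correlation A B g - correlation A' B' g| < ε := by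
  obtain ⟨m, A', hA', hAA⟩ := exists_isSmooth_symmDiff_lt hA (ε := ε / 4) (by positivity)
  obtain ⟨n, B', hB', hBB⟩ := exists_isSmooth_symmDiff_lt hB (ε := ε / 4) (by positivity)
  refine ⟨max m n, A', B', hA'.mono (le_max_left _ _), hB'.mono (le_max_right _ _), fun g => ?_⟩
  refine (abs_correlation_sub_le hA hA'.measurableSet hB hB'.measurableSet g).trans_lt ?_
  linarith

theorem continuous_correlation [Λ.FiniteIndex] {A B : Set (IsoQuotient Λ)}
    (hA : MeasurableSet A) (hB : MeasurableSet B) : Continuous (correlation A B) := by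
  refine Metric.continuous_iff'.2 fun g ε hε => ?_
  obtain ⟨n, A', B', hA', -, h⟩ := exists_isSmooth_correlation_lt hA hB (half_pos hε)
  filter_upwards [(isOpen_leftCoset g n).mem_nhds (x := g) (by simp)] with f hf
  have e : correlation A' B' f = correlation A' B' g := by
    have := correlation_mul_of_isSmooth hA' B' g hf
    rwa [mul_inv_cancel_left] at this
  rw [Real.dist_eq]
  have h1 := h f
  have h2 := h g
  rw [e] at h1
  rw [abs_lt] at h1 h2 ⊢
  constructor <;> linarith

/-- The centred indicator function of a smooth set. -/
noncomputable def centredIndicator [Λ.FiniteIndex] {n : ℕ} {A : Set (IsoQuotient Λ)}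
    (hA : IsSmooth n A) : SmoothFn Λ :=
  ⟨fun x => A.indicator 1 x - (haarProb Λ).real A, ⟨n, fun k hk x => by
      have := hA k hk x
      by_cases hx : x ∈ A
      · simp [hx, this.2 hx]
      · simp [hx, mt this.1 hx]⟩, by
    have hi : Integrable (A.indicator (1 : IsoQuotient Λ → ℝ)) (haarProb Λ) :=
      (integrable_const (1 : ℝ)).indicator hA.measurableSet
    rw [integral_sub hi (integrable_const _), integral_indicator_one hA.measurableSet]
    simp⟩

theorem inner_koopman_centredIndicator [Λ.FiniteIndex] {n : ℕ} {A B : Set (IsoQuotient Λ)}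
    (hA : IsSmooth n A) (hB : IsSmooth n B) (g : Iso d) :
    inner ℝ (SmoothFn.koopman g (centredIndicator hA)) (centredIndicator hB) =
      correlation A B g := by
  set φ := SmoothFn.koopman g (centredIndicator hA) with hφ
  have hφx : ∀ x, φ x = ((fun x => g • x) '' A).indicator 1 x - (haarProb Λ).real A := by
    intro x
    rw [image_smul_eq_preimage]
    rfl
  have hgA := measurableSet_image_smul g hA.measurableSet
  have hφi : Integrable φ.1 (haarProb Λ) := let ⟨_, h⟩ := φ.2.1; h.integrable
  have hi : ∀ C : Set (IsoQuotient Λ), MeasurableSet C →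
      Integrable (C.indicator (1 : IsoQuotient Λ → ℝ)) (haarProb Λ) :=
    fun C hC => (integrable_const (1 : ℝ)).indicator hC
  have hprod : ∀ x, φ x * centredIndicator hB x =
      (((fun x => g • x) '' A ∩ B).indicator (1 : IsoQuotient Λ → ℝ) x -
        (haarProb Λ).real A * B.indicator (1 : IsoQuotient Λ → ℝ) x) -
        φ x * (haarProb Λ).real B := by
    intro x
    have : centredIndicator hB x = B.indicator 1 x - (haarProb Λ).real B := rfl
    rw [this, Set.inter_indicator_one, Pi.mul_apply, hφx]
    ring
  rw [SmoothFn.inner_def]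
  simp only [hprod]
  have hi' : Integrable (fun x => ((fun x => g • x) '' A ∩ B).indicator (1 : IsoQuotient Λ → ℝ) x -
      (haarProb Λ).real A * B.indicator (1 : IsoQuotient Λ → ℝ) x) (haarProb Λ) :=
    (hi _ (hgA.inter hB.measurableSet)).sub ((hi _ hB.measurableSet).const_mul _)
  rw [integral_sub hi' (hφi.mul_const _),
    integral_sub (hi _ (hgA.inter hB.measurableSet)) ((hi _ hB.measurableSet).const_mul _),
    integral_mul_const, φ.2.2, integral_const_mul, integral_indicator_one hB.measurableSet,
    integral_indicator_one (hgA.inter hB.measurableSet), zero_mul, sub_zero, correlation]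

theorem isMixing_iso [Λ.FiniteIndex] (hd : 2 ≤ d) (hΛ : ¬ Λ ≤ evenSubgroup d) :
    IsMixing (Iso d) (haarProb Λ) := by
  intro A B hA hB ε hε
  obtain ⟨n, A', B', hA', hB', h⟩ := exists_isSmooth_correlation_lt hA hB (half_pos hε)
  obtain ⟨R, hR⟩ := SmoothFn.exists_inner_koopman_le hd hΛ (centredIndicator hA')
    (centredIndicator hB') (half_pos hε)
  refine (isCompact_norm_apply_one_le R).of_isClosed_subset
    (isClosed_le continuous_const (continuous_correlation hA hB).abs) fun g hg => ?_
  have hg' : ε ≤ |correlation A B g| := hg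
  by_contra hRg
  have h1 := hR g (not_le.1 hRg).le
  rw [inner_koopman_centredIndicator] at h1
  have h2 := h g
  have h3 := abs_sub_abs_le_abs_sub (correlation A B g) (correlation A' B' g)
  linarith

/-- `F_d` is a closed discrete subgroup of `Iso(F_d)`, so it inherits mixing. -/
theorem isMixing_of_isMixing_iso (h : IsMixing (Iso d) (haarProb Λ)) :
    IsMixing (F d) (haarProb Λ) := by
  intro A B hA hB ε hε
  have hC := h A B hA hB ε hε
  refine Set.Finite.isCompact (((hC.image (continuous_eval 1)).finite_of_discrete).subset ?_)
  intro γ hγ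
  exact ⟨leftMul d γ, hγ, mul_one γ⟩

/-- If `Λ` is even, the even elements of `F_d` preserve the set of all `[f]` with `|f(1)|` even,
which has measure one half, so the action is not mixing. -/
theorem not_le_evenSubgroup_of_isMixing [Λ.FiniteIndex] (hd : 2 ≤ d)
    (h : IsMixing (F d) (haarProb Λ)) : ¬ Λ ≤ evenSubgroup d := by
  intro hΛ
  let A : Set (IsoQuotient Λ) := {x | ∃ f, proj Λ f = x ∧ Even (f.1 1).norm}
  have hA : ∀ f, proj Λ f ∈ A ↔ Even (f.1 1).norm := by
    intro f
    refine ⟨?_, fun hf => ⟨f, rfl, hf⟩⟩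
    rintro ⟨f', hf', he⟩
    obtain ⟨γ, hγ, rfl⟩ := proj_eq_proj.1 hf'
    rw [mul_apply, leftMul_apply, even_norm_mul] at he
    exact he.1 (hΛ hγ)
  have hAγ : ∀ (γ : F d) x, γ • x ∈ A ↔ (x ∈ A ↔ Even γ.norm) := by
    intro γ x
    obtain ⟨f, rfl⟩ := proj_surjective x
    rw [smul_def_leftMul, smul_proj, hA, hA, mul_apply, leftMul_inv_apply, mul_one,
      even_norm_apply, FreeGroup.norm_inv_eq]
  have hAsmooth : IsSmooth 0 A := by
    intro k hk x
    obtain ⟨f, rfl⟩ := proj_surjective x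
    rw [smul_proj, hA, hA, mul_apply, apply_one_of_mem_fixBall (inv_mem hk)]
  have hAm := hAsmooth.measurableSet
  let i : Fin d := ⟨0, by omega⟩
  have hhalf : (haarProb Λ).real A = 1 / 2 := by
    have h1 : (fun x : IsoQuotient Λ => leftMul d (FreeGroup.of i) • x) ⁻¹' A = Aᶜ := by
      ext x
      rw [Set.mem_preimage, ← smul_def_leftMul, hAγ, FreeGroup.norm_of, Set.mem_compl_iff]
      simp
    have h2 := (measurePreserving_smul (Λ := Λ) (leftMul d (FreeGroup.of i))).measureReal_preimage
      hAm.nullMeasurableSet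
    rw [h1, probReal_compl_eq_one_sub hAm] at h2
    linarith
  have hcomp := h A A hAm hAm (1 / 4) (by norm_num)
  have hinj : Function.Injective fun m : ℕ => (FreeGroup.of i : F d) ^ (2 * m) := by
    intro m n hmn
    have := congrArg FreeGroup.norm hmn
    simp only [FreeGroup.norm_of_pow] at this
    omega
  refine Set.infinite_range_of_injective hinj (hcomp.finite_of_discrete.subset ?_)
  rintro _ ⟨m, rfl⟩
  have himage : (fun x : IsoQuotient Λ => (FreeGroup.of i : F d) ^ (2 * m) • x) '' A = A := by
    rw [image_smul_eq_preimage]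
    ext x
    rw [Set.mem_preimage, hAγ, FreeGroup.norm_inv_eq, FreeGroup.norm_of_pow]
    simp
  rw [Set.mem_ofPred_eq, himage, Set.inter_self, hhalf]
  norm_num

end FreeIso

theorem mainTheorem4 (d : ℕ) (hd : 2 ≤ d) (Λ : Subgroup (FreeIso.F d)) [Λ.FiniteIndex] :
    MeasureTheory.IsProbabilityMeasure (FreeIso.haarProb Λ) ∧
    (∀ g : FreeIso.Iso d, MeasureTheory.MeasurePreserving
      (fun x : FreeIso.IsoQuotient Λ => g • x) (FreeIso.haarProb Λ) (FreeIso.haarProb Λ)) ∧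
    List.TFAE [
      FreeIso.IsMixing (FreeIso.Iso d) (FreeIso.haarProb Λ),
      FreeIso.IsMixing (FreeIso.F d) (FreeIso.haarProb Λ),
      ¬ Λ ≤ FreeIso.evenSubgroup d] := by
  refine ⟨inferInstance, FreeIso.measurePreserving_smul, ?_⟩
  tfae_have 1 → 2 := FreeIso.isMixing_of_isMixing_iso
  tfae_have 2 → 3 := FreeIso.not_le_evenSubgroup_of_isMixing hd
  tfae_have 3 → 1 := FreeIso.isMixing_iso hd
  tfae_finish
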